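/- Let $H$ be a complex Hilbert space and $A$ a self-adjoint operator on $H$ with $A\ge c\,\mathbb 1$ for some $c>0$ and with compact resolvent. Let $(e_k)_{k\in\mathbb N}$ be an orthonormal basis of eigenvectors, $Ae_k=\lambda_ke_k$, and let $s\ge 0$ satisfy $\sum_{k}\lambda_k^{-(s+1)}<\infty$. Let $H^{-s}$ be the completion of $H$ for the norm $\|A^{-s/2}\cdot\|_H$, regarded as a real Hilbert space with $\langle\cdot,\cdot\rangle_{H^{-s}_{\mathbb R}}=\mathrm{Re}\langle\cdot,A^{-s}\cdot\rangle_H$. The operators $e^{itA}$, $A^{-(s+1)}$ and the real pairings $\langle u,e_k\rangle$, $\langle u,ie_k\rangle$ extending $\mathrm{Re}\langle\cdot,\cdot\rangle_H$ are extended to $u\in H^{-s}$ by continuity, and $A$ maps $H^{-s}$ to $H^{-s-2}$. Let $\mathscr C^\infty_{b,cyl}(H^{-s})$ be the set of functions $F(u)=\varphi(\langle u,e_1\rangle,\dots,\langle u,e_n\rangle;\langle u,ie_1\rangle,\dots,\langle u,ie_n\rangle)$ with $n\in\mathbb N$ and $\varphi:\mathbb R^{2n}\to\mathbb R$ smooth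 and bounded together with all its derivatives; put $\nabla F(u)=\sum_{k=1}^n\big(\partial_k\varphi(\cdots)\,e_k+\partial_{n+k}\varphi(\cdots)\,ie_k\big)$, and let $\langle\cdot,\cdot\rangle$ be the real duality pairing extending $\mathrm{Re}\langle\cdot,\cdot\rangle_H$. Let $\nu_0$ be the centred Gaussian probability measure on $H^{-s}$ with $$\int_{H^{-s}} e^{i\langle u,\xi\rangle_{H^{-s}_{\mathbb R}}}\,\nu_0(du)=e^{-\frac12\langle\xi,A^{-(s+1)}\xi\rangle_{H^{-s}_{\mathbb R}}}\qquad(\xi\in H^{-s}).$$ Let $h_{NL}:H^{-s}\to\mathbb R$ belong to the Gross–Sobolev space $\mathbb D^{1,2}(\nu_0)$, with Malliavin derivative $\nabla h_{NL}\in L^2(\nu_0;H^{-s})$; that is, $(h_{NL},\nabla h_{NL})$ lies in the closure in $L^2(\nu_0)\times L^2(\nu_0;H^{-s})$ of $\{(F,\nabla F):F\in\mathscr C^\infty_{b,cyl}(H^{-s})\}$. Assume $e^{-h_{NL}}\in L^2(\nu_0)$. Put $$d\mu_0=\frac{e^{-h_{NL}}\,d\nu_0}{\int_{H^{-s}}e^{-h_{NL}}\,d\nu_0},\qquad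 \mu_t=(e^{itA})_\sharp\mu_0,\qquad v(t,u)=-i\,e^{itA}\,\nabla h_{NL}(e^{-itA}u).$$ Then: 1. $\mu_0$ is a well-defined probability measure. 2. (Stationarity.) For every $F\in\mathscr C^\infty_{b,cyl}(H^{-s})$ the function $u\mapsto\langle\nabla F(u),-iAu-i\nabla h_{NL}(u)\rangle$ is $\mu_0$-integrable and $$\int_{H^{-s}}\langle\nabla F(u),-iAu-i\nabla h_{NL}(u)\rangle\,\mu_0(du)=0.$$ 3. (Statistical Liouville equation.) The curve $(\mu_t)_{t\in\mathbb R}$ is narrowly continuous, $v(t,\cdot)$ is $\mu_t$-integrable for every $t$, the function $t\mapsto\frac1{1+t^2}\int_{H^{-s}}\|v(t,u)\|_{H^{-s}}\,\mu_t(du)$ is integrable on $\mathbb R$, and for every $t\in\mathbb R$ and every $F\in\mathscr C^\infty_{b,cyl}(H^{-s})$ the function $\tau\mapsto\int F\,d\mu_\tau$ is differentiable at $t$, $\langle v(t,\cdot),\nabla F\rangle$ is $\mu_t$-integrable, and $$\frac{d}{dt}\int_{H^{-s}}F(u)\,\mu_t(du)=\int_{H^{-s}}\langle v(t,u),\nabla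 F(u)\rangle\,\mu_t(du).$$ -/

import Mathlib

open MeasureTheory Filter Topology Complex UniformSpace
open scoped NNReal ENNReal ContDiff InnerProductSpace ComplexConjugate

noncomputable section

/-- An unbounded operator `A` has compact resolvent: for some `z`, the operator `A - z` is a
bijection from its domain onto `H` with a compact (bounded) inverse. -/
def HasCompactResolvent {H : Type*} [NormedAddCommGroup H] [InnerProductSpace ℂ H]
    (A : H →ₗ.[ℂ] H) : Prop :=
  ∃ (z : ℂ) (R : H →L[ℂ] H), IsCompactOperator R ∧
    (∀ y : H, ∃ hy : R y ∈ A.domain, A ⟨R y, hy⟩ - z • R y = y) ∧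
    ∀ x : A.domain, R (A x - z • (x : H)) = x

/-- The linear framework: a self-adjoint operator `A ≥ c > 0` with compact resolvent on a complex
Hilbert space `H`, together with a choice of an orthonormal basis `(e k)` of eigenvectors of `A`,
with eigenvalues `(lam k)`. (Such a basis exists by the spectral theorem; it is fixed here since the
cylindrical functions below refer to it.) -/
structure SpectralSetup (H : Type*) [NormedAddCommGroup H] [InnerProductSpace ℂ H]
    [CompleteSpace H] where
  A : H →ₗ.[ℂ] H
  selfAdjoint : IsSelfAdjoint A
  c : ℝ
  c_pos : 0 < c
  lower_bound : ∀ x : A.domain, c * ‖(x : H)‖ ^ 2 ≤ (inner ℂ (x : H) (A x)).re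
  compactResolvent : HasCompactResolvent A
  e : HilbertBasis ℕ ℂ H
  lam : ℕ → ℝ
  e_mem : ∀ k, e k ∈ A.domain
  eigen : ∀ k, A ⟨e k, e_mem k⟩ = (lam k : ℂ) • e k

namespace SpectralSetup

variable {H : Type*} [NormedAddCommGroup H] [InnerProductSpace ℂ H] [CompleteSpace H]

theorem c_le_lam (S : SpectralSetup H) (k : ℕ) : S.c ≤ S.lam k := by
  have h := S.lower_bound ⟨S.e k, S.e_mem k⟩
  have h1 : ‖S.e k‖ = 1 := S.e.orthonormal.1 k
  rw [S.eigen k, inner_smul_right, inner_self_eq_norm_sq_to_K] at h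
  simpa [h1] using h

theorem lam_pos (S : SpectralSetup H) (k : ℕ) : 0 < S.lam k :=
  S.c_pos.trans_le (S.c_le_lam k)

/-! ### Functions of `A` -/

/-- Multiplication of square-summable sequences by a bounded sequence. -/
def seqMul (m : ℕ → ℂ) (hm : ∃ C : ℝ, ∀ k, ‖m k‖ ≤ C) :
    lp (fun _ : ℕ => ℂ) 2 →L[ℂ] lp (fun _ : ℕ => ℂ) 2 :=
  LinearMap.mkContinuousOfExistsBound
    { toFun := fun x => ⟨fun k => m k * x k, by
        obtain ⟨C, hC⟩ := hm
        refine Memℓp.mono' ((lp.memℓp x).const_mul (C : ℂ)) fun k => ?_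
        rw [norm_mul, norm_mul, Complex.norm_real]
        exact mul_le_mul_of_nonneg_right ((hC k).trans (le_abs_self C)) (norm_nonneg _)⟩
      map_add' := fun x y => by ext k; exact mul_add (m k) (x k) (y k)
      map_smul' := fun a x => by ext k; exact mul_left_comm (m k) a (x k) }
    (by
      obtain ⟨C, hC⟩ := hm
      refine ⟨|C|, fun x => ?_⟩
      have h : ‖(⟨fun k => (C : ℂ) * x k, (lp.memℓp x).const_mul (C : ℂ)⟩ :
          lp (fun _ : ℕ => ℂ) 2)‖ = |C| * ‖x‖ := by
        rw [← Real.norm_eq_abs, ← Complex.norm_real, ← norm_smul]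
        congr 1
      rw [← h]
      refine lp.norm_mono (by norm_num) fun k => ?_
      change ‖m k * x k‖ ≤ ‖(C : ℂ) * x k‖
      rw [norm_mul, norm_mul, Complex.norm_real]
      exact mul_le_mul_of_nonneg_right ((hC k).trans (le_abs_self C)) (norm_nonneg _))

/-- The bounded operator `x ↦ ∑ₖ mₖ ⟨eₖ, x⟩ eₖ` on `H`; it is `f(A)` when `mₖ = f(lamₖ)`. -/
def diag (S : SpectralSetup H) (m : ℕ → ℂ) (hm : ∃ C : ℝ, ∀ k, ‖m k‖ ≤ C) : H →L[ℂ] H :=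
  (S.e.repr.symm.toContinuousLinearEquiv : lp (fun _ : ℕ => ℂ) 2 →L[ℂ] H) ∘L
    seqMul m hm ∘L (S.e.repr.toContinuousLinearEquiv : H →L[ℂ] lp (fun _ : ℕ => ℂ) 2)

theorem repr_diag (S : SpectralSetup H) (m : ℕ → ℂ) (hm : ∃ C : ℝ, ∀ k, ‖m k‖ ≤ C) (x : H)
    (k : ℕ) : S.e.repr (S.diag m hm x) k = m k * S.e.repr x k := by
  simp only [diag, ContinuousLinearMap.comp_apply, ContinuousLinearEquiv.coe_coe,
    LinearIsometryEquiv.coe_toContinuousLinearEquiv, LinearIsometryEquiv.apply_symm_apply]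
  rfl

/-- The multiplier of `A ^ (-r)`, for `r ≥ 0`. -/
def negPow (S : SpectralSetup H) (r : ℝ≥0) (k : ℕ) : ℂ := ((S.lam k ^ (-(r : ℝ)) : ℝ) : ℂ)

theorem negPow_bdd (S : SpectralSetup H) (r : ℝ≥0) : ∃ C : ℝ, ∀ k, ‖S.negPow r k‖ ≤ C := by
  refine ⟨S.c ^ (-(r : ℝ)), fun k => ?_⟩
  rw [negPow, Complex.norm_real, Real.norm_of_nonneg (Real.rpow_nonneg (S.lam_pos k).le _)]
  exact Real.rpow_le_rpow_of_nonpos S.c_pos (S.c_le_lam k) (by simp)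

/-- The multiplier of `e^{itA}`. -/
def expMul (S : SpectralSetup H) (t : ℝ) (k : ℕ) : ℂ := Complex.exp (t * S.lam k * I)

theorem expMul_bdd (S : SpectralSetup H) (t : ℝ) : ∃ C : ℝ, ∀ k, ‖S.expMul t k‖ ≤ C := by
  refine ⟨1, fun k => ?_⟩
  rw [expMul, ← Complex.ofReal_mul, Complex.norm_exp_ofReal_mul_I]

/-! ### The Sobolev spaces of negative exponent -/

/-- The vector space `H`, to be equipped with the norm `‖A^{-s/2} ·‖_H`. -/
def PreHneg (_S : SpectralSetup H) (_s : ℝ≥0) : Type _ := H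

instance (S : SpectralSetup H) (s : ℝ≥0) : AddCommGroup (S.PreHneg s) :=
  inferInstanceAs (AddCommGroup H)

instance (S : SpectralSetup H) (s : ℝ≥0) : Module ℂ (S.PreHneg s) :=
  inferInstanceAs (Module ℂ H)

/-- The identity map from `H` to `H` with the norm `‖A^{-s/2} ·‖_H`. -/
def toPre (S : SpectralSetup H) (s : ℝ≥0) : H ≃ₗ[ℂ] S.PreHneg s :=
  LinearEquiv.refl ℂ H

/-- The operator `A^{-s/2}`, as a map from `H` with the norm `‖A^{-s/2} ·‖_H` to `H`. -/
def weight (S : SpectralSetup H) (s : ℝ≥0) : S.PreHneg s →ₗ[ℂ] H :=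
  (S.diag (S.negPow (s / 2)) (S.negPow_bdd _) : H →ₗ[ℂ] H) ∘ₗ (S.toPre s).symm.toLinearMap

theorem repr_weight (S : SpectralSetup H) (s : ℝ≥0) (x : S.PreHneg s) (k : ℕ) :
    S.e.repr (S.weight s x) k = S.negPow (s / 2) k * S.e.repr ((S.toPre s).symm x) k :=
  S.repr_diag _ _ _ k

theorem weight_injective (S : SpectralSetup H) (s : ℝ≥0) :
    Function.Injective (S.weight s) := by
  intro x y hxy
  apply (S.toPre s).symm.injective
  apply S.e.repr.injective
  ext k
  have h : S.e.repr (S.weight s x) k = S.e.repr (S.weight s y) k := by rw [hxy]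
  rw [repr_weight, repr_weight] at h
  exact mul_left_cancel₀
    (Complex.ofReal_ne_zero.2 (Real.rpow_pos_of_pos (S.lam_pos k) _).ne') h

instance (S : SpectralSetup H) (s : ℝ≥0) : NormedAddCommGroup (S.PreHneg s) :=
  NormedAddCommGroup.induced (S.PreHneg s) H (S.weight s) (S.weight_injective s)

/-- The inner product `⟨x, y⟩_{H^{-s}} = ⟨A^{-s/2} x, A^{-s/2} y⟩_H`. -/
instance (S : SpectralSetup H) (s : ℝ≥0) : InnerProductSpace ℂ (S.PreHneg s) where
  norm_smul_le a x := by
    change ‖S.weight s (a • x)‖ ≤ ‖a‖ * ‖S.weight s x‖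
    rw [map_smul, norm_smul]
  inner x y := inner ℂ (S.weight s x) (S.weight s y)
  norm_sq_eq_re_inner x := norm_sq_eq_re_inner (𝕜 := ℂ) (S.weight s x)
  conj_inner_symm x y := inner_conj_symm (𝕜 := ℂ) (S.weight s x) (S.weight s y)
  add_left x y z := by rw [map_add, inner_add_left]
  smul_left x y a := by rw [map_smul, inner_smul_left]

/-- The Sobolev space `H^{-s}`: the completion of `(H, ‖A^{-s/2} ·‖_H)`. -/
abbrev Hneg (S : SpectralSetup H) (s : ℝ≥0) : Type _ := Completion (S.PreHneg s)

instance (S : SpectralSetup H) (s : ℝ≥0) : MeasurableSpace (S.Hneg s) := borel _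

instance (S : SpectralSetup H) (s : ℝ≥0) : BorelSpace (S.Hneg s) := ⟨rfl⟩

/-- The dense inclusion `H ⊂ H^{-s}`. -/
def emb (S : SpectralSetup H) (s : ℝ≥0) (x : H) : S.Hneg s :=
  (S.toPre s x : Completion (S.PreHneg s))

/-- The operator `diag m`, on `H` with the norm `‖A^{-s/2} ·‖_H`. -/
def preDiag (S : SpectralSetup H) (s : ℝ≥0) (m : ℕ → ℂ) (hm : ∃ C : ℝ, ∀ k, ‖m k‖ ≤ C) :
    S.PreHneg s →L[ℂ] S.PreHneg s :=
  LinearMap.mkContinuousOfExistsBound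
    ((S.toPre s).toLinearMap ∘ₗ (S.diag m hm : H →ₗ[ℂ] H) ∘ₗ (S.toPre s).symm.toLinearMap) (by
    refine ⟨‖S.diag m hm‖, fun x => ?_⟩
    have h : S.weight s (((S.toPre s).toLinearMap ∘ₗ (S.diag m hm : H →ₗ[ℂ] H) ∘ₗ
        (S.toPre s).symm.toLinearMap) x) = S.diag m hm (S.weight s x) := by
      apply S.e.repr.injective
      ext k
      rw [repr_diag, repr_weight, repr_weight]
      simp only [LinearMap.comp_apply, LinearEquiv.coe_coe, LinearEquiv.symm_apply_apply,
        ContinuousLinearMap.coe_coe, repr_diag]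
      exact mul_left_comm _ _ _
    exact (congrArg norm h).trans_le (ContinuousLinearMap.le_opNorm _ _))

/-- The continuous extension of the operator `diag m` to `H^{-s}`. -/
def diagNeg (S : SpectralSetup H) (s : ℝ≥0) (m : ℕ → ℂ) (hm : ∃ C : ℝ, ∀ k, ‖m k‖ ≤ C) :
    S.Hneg s →L[ℂ] S.Hneg s :=
  (S.preDiag s m hm).completion

/-- The linear flow `e^{itA}` on `H^{-s}`. -/
def flow (S : SpectralSetup H) (s : ℝ≥0) (t : ℝ) : S.Hneg s →L[ℂ] S.Hneg s :=
  S.diagNeg s (S.expMul t) (S.expMul_bdd t)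

/-- The operator `A^{-r}`, for `r ≥ 0`, on `H^{-s}`. -/
def powNeg (S : SpectralSetup H) (s r : ℝ≥0) : S.Hneg s →L[ℂ] S.Hneg s :=
  S.diagNeg s (S.negPow r) (S.negPow_bdd r)

/-- The coordinates `⟨eₖ, u⟩` of `u ∈ H^{-s}`, i.e. the continuous extension to `H^{-s}` of
`x ↦ ⟨eₖ, x⟩_H` (see `coord_emb`). The real numbers `⟨u, eₖ⟩` and `⟨u, i eₖ⟩`, for the real duality
pairing, are its real and imaginary parts. -/
def coord (S : SpectralSetup H) (s : ℝ≥0) (u : S.Hneg s) (k : ℕ) : ℂ :=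
  ((S.lam k ^ (s : ℝ) : ℝ) : ℂ) * inner ℂ (S.emb s (S.e k)) u

theorem coord_emb (S : SpectralSetup H) (s : ℝ≥0) (x : H) (k : ℕ) :
    S.coord s (S.emb s x) k = inner ℂ (S.e k) x := by
  have hw : S.weight s (S.toPre s (S.e k)) = S.negPow (s / 2) k • S.e k := by
    apply S.e.repr.injective
    ext j
    rw [repr_weight, LinearEquiv.symm_apply_apply, map_smul, lp.coeFn_smul, Pi.smul_apply,
      smul_eq_mul, S.e.repr_self]
    rcases eq_or_ne j k with rfl | hjk
    · rfl
    · simp [hjk]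
  have hx : inner ℂ (S.e k) (S.weight s (S.toPre s x)) =
      S.negPow (s / 2) k * inner ℂ (S.e k) x := by
    rw [← S.e.repr_apply_apply, ← S.e.repr_apply_apply, repr_weight,
      LinearEquiv.symm_apply_apply]
  have hi : inner ℂ (S.emb s (S.e k)) (S.emb s x) =
      inner ℂ (S.weight s (S.toPre s (S.e k))) (S.weight s (S.toPre s x)) :=
    Completion.inner_coe _ _
  have h0 : (s : ℝ) + (-((s / 2 : ℝ≥0) : ℝ) + -((s / 2 : ℝ≥0) : ℝ)) = 0 := by
    push_cast; ring
  have h1 : ((S.lam k ^ (s : ℝ) : ℝ) : ℂ) * (S.negPow (s / 2) k * S.negPow (s / 2) k) = 1 := by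
    rw [negPow, ← Complex.ofReal_mul, ← Complex.ofReal_mul, ← Real.rpow_add (S.lam_pos k),
      ← Real.rpow_add (S.lam_pos k), h0, Real.rpow_zero, Complex.ofReal_one]
  have h2 : conj (S.negPow (s / 2) k) = S.negPow (s / 2) k := Complex.conj_ofReal _
  rw [coord, hi, hw, inner_smul_left, hx, h2]
  linear_combination (inner ℂ (S.e k) x) * h1

/-- The real duality pairing `⟨a, x⟩ = Re ∑ₖ conj ⟨eₖ, x⟩ aₖ` of a distribution with coordinates
`a` with a vector `x`; in all uses `x` is a finite combination of the `eₖ`. -/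
def pairing (S : SpectralSetup H) (a : ℕ → ℂ) (x : H) : ℝ :=
  ∑' k, (conj (inner ℂ (S.e k) x) * a k).re

/-- The action of `A` on coordinates; it is `u ↦ A u`, from `H^{-s}` to `H^{-s-2}`. -/
def applyA (S : SpectralSetup H) (a : ℕ → ℂ) (k : ℕ) : ℂ := S.lam k * a k

/-! ### Bounded smooth cylindrical functions -/

/-- `φ` belongs to `C_b^∞(ℂⁿ) = C_b^∞(ℝ²ⁿ)`: it is real-smooth and bounded, together with all its
derivatives. -/
def IsCbInfty {n : ℕ} (φ : (Fin n → ℂ) → ℝ) : Prop :=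
  ContDiff ℝ ∞ φ ∧ ∀ m : ℕ, ∃ C : ℝ, ∀ z, ‖iteratedFDeriv ℝ m φ z‖ ≤ C

/-- The cylindrical function
`F(u) = φ(⟨u, e₁⟩, …, ⟨u, eₙ⟩; ⟨u, i e₁⟩, …, ⟨u, i eₙ⟩)` on `H^{-s}`. -/
def cyl (S : SpectralSetup H) (s : ℝ≥0) {n : ℕ} (φ : (Fin n → ℂ) → ℝ) (u : S.Hneg s) : ℝ :=
  φ fun k => S.coord s u k

/-- The gradient `∑ₖ ∂_{xₖ} φ(…) eₖ + ∑ₖ ∂_{yₖ} φ(…) i eₖ` of the cylindrical function `cyl φ`, where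
`φ` is regarded as a function of the real and imaginary parts `xₖ`, `yₖ` of its arguments. -/
def cylGrad (S : SpectralSetup H) (s : ℝ≥0) {n : ℕ} (φ : (Fin n → ℂ) → ℝ) (u : S.Hneg s) : H :=
  ∑ k : Fin n,
    (((fderiv ℝ φ (fun j => S.coord s u j) (Pi.single k 1) : ℝ) : ℂ) • S.e k +
      ((fderiv ℝ φ (fun j => S.coord s u j) (Pi.single k I) : ℝ) : ℂ) • I • S.e k)

/-! ### The Gaussian measure, the Gross-Sobolev space and the Gibbs measure -/

/-- `ν` is the centred Gaussian probability measure on `H^{-s}` with covariance `A^{-(s+1)}`,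
given by its characteristic function with respect to the real inner product of `H^{-s}`. -/
def IsGaussian (S : SpectralSetup H) (s : ℝ≥0) (ν : Measure (S.Hneg s)) : Prop :=
  IsProbabilityMeasure ν ∧ ∀ ξ : S.Hneg s,
    ∫ u, Complex.exp (I * ((inner ℂ u ξ).re : ℂ)) ∂ν =
      Complex.exp (-(1 / 2) * ((inner ℂ ξ (S.powNeg s (s + 1) ξ)).re : ℂ))

/-- `h` belongs to the Gross-Sobolev space `𝔻^{1,2}(ν)` and `g` is (a version of) its Malliavin
derivative `∇h`: the pair `(h, g)` lies in the closure in `L²(ν) × L²(ν; H^{-s})` of the graph of the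
gradient on bounded smooth cylindrical functions. -/
def IsMalliavinDeriv (S : SpectralSetup H) (s : ℝ≥0) (ν : Measure (S.Hneg s))
    (h : S.Hneg s → ℝ) (g : S.Hneg s → S.Hneg s) : Prop :=
  MemLp h 2 ν ∧ MemLp g 2 ν ∧
    ∃ (n : ℕ → ℕ) (φ : (j : ℕ) → (Fin (n j) → ℂ) → ℝ), (∀ j, IsCbInfty (φ j)) ∧
      Tendsto (fun j => eLpNorm (fun u => S.cyl s (φ j) u - h u) 2 ν) atTop (𝓝 0) ∧
      Tendsto (fun j => eLpNorm (fun u => S.emb s (S.cylGrad s (φ j) u) - g u) 2 ν)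
        atTop (𝓝 0)

/-- The Gibbs measure `μ₀ = e^{-h} ν / ∫ e^{-h} dν`. -/
def gibbs (S : SpectralSetup H) (s : ℝ≥0) (ν : Measure (S.Hneg s)) (h : S.Hneg s → ℝ) :
    Measure (S.Hneg s) :=
  (∫⁻ u, ENNReal.ofReal (Real.exp (-h u)) ∂ν)⁻¹ •
    ν.withDensity fun u => ENNReal.ofReal (Real.exp (-h u))

/-- The transported Gibbs measure `μ_t = (e^{itA})_♯ μ₀`. -/
def gibbsAt (S : SpectralSetup H) (s : ℝ≥0) (ν : Measure (S.Hneg s)) (h : S.Hneg s → ℝ) (t : ℝ) :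
    Measure (S.Hneg s) :=
  (S.gibbs s ν h).map (S.flow s t)

/-- The vector field `v(t, u) = -i e^{itA} g(e^{-itA} u)`, where `g = ∇h`. -/
def vectorField (S : SpectralSetup H) (s : ℝ≥0) (g : S.Hneg s → S.Hneg s) (t : ℝ)
    (u : S.Hneg s) : S.Hneg s :=
  -(I • S.flow s t (g (S.flow s (-t) u)))

end SpectralSetup

end

/-!
For the Gaussian measure `ν₀` the coordinate `⟨·, c eₖ⟩` is independent of the complementary
component, so one-dimensional Gaussian integration by parts shows that the direction `c eₖ` has
divergence `λₖ ⟨u, c eₖ⟩`. The chain rule for `e^{-h}`, obtained from bounded cutoffs of the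
exponential and approximation of `h` by cylindrical functions, turns this into the divergence `λₖ
⟨u, c eₖ⟩ + ⟨∇h(u), c eₖ⟩` for the Gibbs measure. The Hamiltonian field pairs `eₖ` with `i eₖ`, so
after integrating by parts the second derivatives of `φ` cancel by symmetry: this is stationarity.
Applied to `F ∘ e^{itA}`, stationarity says that the pairing with `-iA`, which is minus the
`t`-derivative of `∫ F ∘ e^{itA} dμ₀`, balances the pairing with `-i∇h`: this is the Liouville
equation.
-/

noncomputable section

/-! ### Integration by parts along a fixed direction -/

section Fomin

variable {E : Type*} [AddCommGroup E] [Module ℝ E] [TopologicalSpace E] {d : E}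

/-- `G` is a test function for integration by parts along the direction `d`: it is continuous and
bounded, and it has a continuous bounded derivative `G'` along `d`. -/
structure IsTestAlong (d : E) (G G' : E → ℝ) : Prop where
  continuous : Continuous G
  continuous_deriv : Continuous G'
  bounded : ∃ C, ∀ u, |G u| ≤ C
  deriv_bounded : ∃ C, ∀ u, |G' u| ≤ C
  hasLineDerivAt : ∀ u, HasLineDerivAt ℝ G (G' u) u d

namespace IsTestAlong

theorem mul {F F' G G' : E → ℝ} (hF : IsTestAlong d F F') (hG : IsTestAlong d G G') :
    IsTestAlong d (fun u => F u * G u) (fun u => F' u * G u + F u * G' u) where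
  continuous := hF.continuous.mul hG.continuous
  continuous_deriv :=
    (hF.continuous_deriv.mul hG.continuous).add (hF.continuous.mul hG.continuous_deriv)
  bounded := by
    obtain ⟨C, hC⟩ := hF.bounded
    obtain ⟨D, hD⟩ := hG.bounded
    refine ⟨C * D, fun u => ?_⟩
    rw [abs_mul]
    have := (abs_nonneg _).trans (hC u)
    gcongr
    exacts [hC u, hD u]
  deriv_bounded := by
    obtain ⟨C, hC⟩ := hF.bounded
    obtain ⟨C', hC'⟩ := hF.deriv_bounded
    obtain ⟨D, hD⟩ := hG.bounded
    obtain ⟨D', hD'⟩ := hG.deriv_bounded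
    refine ⟨C' * D + C * D', fun u => (abs_add_le _ _).trans ?_⟩
    rw [abs_mul, abs_mul]
    have := (abs_nonneg _).trans (hC u)
    have := (abs_nonneg _).trans (hC' u)
    gcongr
    exacts [hC' u, hD u, hC u, hD' u]
  hasLineDerivAt u := by
    simpa [HasLineDerivAt] using (hF.hasLineDerivAt u).fun_mul (hG.hasLineDerivAt u)

theorem comp {F F' : E → ℝ} (hF : IsTestAlong d F F') {ψ ψ' : ℝ → ℝ} {C C' : ℝ}
    (hψ : ∀ x, HasDerivAt ψ (ψ' x) x) (hψ' : Continuous ψ') (hC : ∀ x, |ψ x| ≤ C)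
    (hC' : ∀ x, |ψ' x| ≤ C') :
    IsTestAlong d (fun u => ψ (F u)) (fun u => ψ' (F u) * F' u) where
  continuous := (continuous_iff_continuousAt.2 fun x => (hψ x).continuousAt).comp hF.continuous
  continuous_deriv := (hψ'.comp hF.continuous).mul hF.continuous_deriv
  bounded := ⟨C, fun _ => hC _⟩
  deriv_bounded := by
    obtain ⟨D, hD⟩ := hF.deriv_bounded
    refine ⟨C' * D, fun u => ?_⟩
    rw [abs_mul]
    have := (abs_nonneg _).trans (hC' (F u))
    gcongr
    exacts [hC' _, hD u]
  hasLineDerivAt u := (hψ _).comp_of_eq (0 : ℝ) (hF.hasLineDerivAt u) (by simp)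

theorem comp_line [ContinuousAdd E] [ContinuousSMul ℝ E] {G G' : E → ℝ}
    (hG : IsTestAlong d G G') (u : E) :
    IsTestAlong (1 : ℝ) (fun r => G (u + r • d)) (fun r => G' (u + r • d)) where
  continuous := hG.continuous.comp (by fun_prop)
  continuous_deriv := hG.continuous_deriv.comp (by fun_prop)
  bounded := hG.bounded.imp fun _ hC _ => hC _
  deriv_bounded := hG.deriv_bounded.imp fun _ hC _ => hC _
  hasLineDerivAt r := by
    simpa [HasLineDerivAt, add_smul, add_assoc] using hG.hasLineDerivAt (u + r • d)

theorem hasDerivAt {G G' : ℝ → ℝ} (hG : IsTestAlong 1 G G') (x : ℝ) : HasDerivAt G (G' x) x := by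
  have h := hG.hasLineDerivAt x
  simp only [HasLineDerivAt, smul_eq_mul, mul_one] at h
  simpa using HasDerivAt.comp_sub_const (f := fun t => G (x + t)) x x (by rwa [sub_self])

variable [MeasurableSpace E] [OpensMeasurableSpace E] {μ : Measure E}

theorem memLp [IsFiniteMeasure μ] {G G' : E → ℝ} (hG : IsTestAlong d G G') (p : ℝ≥0∞) :
    MemLp G p μ :=
  let ⟨_, hC⟩ := hG.bounded
  .of_bound hG.continuous.aestronglyMeasurable _ (.of_forall hC)

theorem memLp_deriv [IsFiniteMeasure μ] {G G' : E → ℝ} (hG : IsTestAlong d G G') (p : ℝ≥0∞) :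
    MemLp G' p μ :=
  let ⟨_, hC⟩ := hG.deriv_bounded
  .of_bound hG.continuous_deriv.aestronglyMeasurable _ (.of_forall hC)

theorem integrable_mul {G G' f : E → ℝ} (hG : IsTestAlong d G G') (hf : Integrable f μ) :
    Integrable (fun u => G u * f u) μ :=
  let ⟨_, hC⟩ := hG.bounded
  hf.bdd_mul hG.continuous.aestronglyMeasurable (.of_forall hC)

end IsTestAlong

variable [MeasurableSpace E]

/-- `β` is the Gaussian-type divergence of the constant vector field `d` with respect to `μ`:
`∫ ∂_d G dμ = ∫ G β dμ` for all test functions `G`. In Fomin's terminology, `-β` is the logarithmic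
derivative of `μ` along `d`. -/
structure HasFominDivergence (μ : Measure E) (d : E) (β : E → ℝ) : Prop where
  integrable : Integrable β μ
  integral_deriv : ∀ {G G' : E → ℝ}, IsTestAlong d G G' → ∫ u, G' u ∂μ = ∫ u, G u * β u ∂μ

/-- `f'` is a weak derivative of `f` along `d`, where `μ` has divergence `β` along `d`: the product
rule `∫ (∂_d G f + G f') dμ = ∫ G f β dμ` holds for all test functions `G`. -/
structure HasWeakLineDeriv (μ : Measure E) (d : E) (β f f' : E → ℝ) : Prop where
  memLp : MemLp f 2 μ
  integrable_deriv : Integrable f' μ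
  integral_eq_zero : ∀ {G G' : E → ℝ}, IsTestAlong d G G' →
    ∫ u, ((G' u - G u * β u) * f u + G u * f' u) ∂μ = 0

/-- `f` belongs to the Sobolev space `W^{1,2}` along the direction `d`, with derivative `f'`: the
pair `(f, f')` is a limit in `L²(μ) × L²(μ)` of test functions and their derivatives. -/
structure HasSobolevLineDeriv (μ : Measure E) (d : E) (f f' : E → ℝ) : Prop where
  memLp : MemLp f 2 μ
  memLp_deriv : MemLp f' 2 μ
  exists_approx : ∃ F F' : ℕ → E → ℝ, (∀ j, IsTestAlong d (F j) (F' j)) ∧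
    Tendsto (fun j => eLpNorm (F j - f) 2 μ) atTop (𝓝 0) ∧
    Tendsto (fun j => eLpNorm (F' j - f') 2 μ) atTop (𝓝 0)

end Fomin

section Convergence

variable {α ι : Type*} [MeasurableSpace α] {μ : Measure α} {l : Filter ι}

theorem tendsto_eLpNorm_mul_zero {p q r : ℝ≥0∞} [ENNReal.HolderTriple p q r] {k : α → ℝ}
    {f : ι → α → ℝ} (hk : MemLp k p μ) (hf : ∀ i, AEStronglyMeasurable (f i) μ)
    (hf0 : Tendsto (fun i => eLpNorm (f i) q μ) l (𝓝 0)) :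
    Tendsto (fun i => eLpNorm (k * f i) r μ) l (𝓝 0) := by
  refine tendsto_of_tendsto_of_tendsto_of_le_of_le tendsto_const_nhds ?_ (fun i => zero_le)
    fun i => eLpNorm_smul_le_mul_eLpNorm (𝕜 := ℝ) (p := p) (q := q) (hf i) hk.1
  simpa only [mul_zero] using ENNReal.Tendsto.const_mul hf0 (.inr hk.eLpNorm_ne_top)

theorem tendsto_eLpNorm_zero_of_norm_le {p : ℝ≥0∞} {f g : ι → α → ℝ}
    (hfg : ∀ i x, ‖f i x‖ ≤ ‖g i x‖) (hg : Tendsto (fun i => eLpNorm (g i) p μ) l (𝓝 0)) :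
    Tendsto (fun i => eLpNorm (f i) p μ) l (𝓝 0) :=
  tendsto_of_tendsto_of_tendsto_of_le_of_le tendsto_const_nhds hg (fun _ => zero_le)
    fun i => eLpNorm_mono (hfg i)

theorem tendsto_eLpNorm_clm_comp_zero {E : Type*} [NormedAddCommGroup E] [NormedSpace ℝ E]
    {p : ℝ≥0∞} (L : E →L[ℝ] ℝ) {f : ι → α → E}
    (hf : Tendsto (fun i => eLpNorm (f i) p μ) l (𝓝 0)) :
    Tendsto (fun i => eLpNorm (fun x => L (f i x)) p μ) l (𝓝 0) := by
  refine tendsto_of_tendsto_of_tendsto_of_le_of_le tendsto_const_nhds ?_ (fun _ => zero_le)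
    fun i => eLpNorm_le_nnreal_smul_eLpNorm_of_ae_le_mul
      (.of_forall fun x => L.le_opNNNorm (f i x)) p
  simpa only [ENNReal.smul_def, smul_eq_mul, mul_zero] using
    ENNReal.Tendsto.const_mul hf (.inr ENNReal.coe_ne_top)

theorem tendsto_eLpNorm_add_zero {p : ℝ≥0∞} (hp : 1 ≤ p) {f g : ι → α → ℝ}
    (hf : ∀ i, AEStronglyMeasurable (f i) μ) (hg : ∀ i, AEStronglyMeasurable (g i) μ)
    (hf0 : Tendsto (fun i => eLpNorm (f i) p μ) l (𝓝 0))
    (hg0 : Tendsto (fun i => eLpNorm (g i) p μ) l (𝓝 0)) :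
    Tendsto (fun i => eLpNorm (f i + g i) p μ) l (𝓝 0) :=
  tendsto_of_tendsto_of_tendsto_of_le_of_le tendsto_const_nhds (by simpa using hf0.add hg0)
    (fun _ => zero_le) fun i => eLpNorm_add_le (hf i) (hg i) hp

theorem tendsto_eLpNorm_comp_sub {p : ℝ≥0∞} {ψ : ℝ → ℝ} {K : ℝ≥0} (hψ : LipschitzWith K ψ)
    {f : ι → α → ℝ} {g : α → ℝ} (hf : ∀ i, AEStronglyMeasurable (f i) μ)
    (hg : AEStronglyMeasurable g μ) (hfg : Tendsto (fun i => eLpNorm (f i - g) p μ) l (𝓝 0)) :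
    Tendsto (fun i => eLpNorm ((fun x => ψ (f i x)) - fun x => ψ (g x)) p μ) l (𝓝 0) := by
  refine tendsto_eLpNorm_zero_of_norm_le (fun i x => ?_)
    (tendsto_eLpNorm_mul_zero (memLp_top_const (K : ℝ)) (fun i => (hf i).sub hg) hfg)
  simpa [Real.dist_eq] using hψ.dist_le_mul (f i x) (g x)

/-- `aᵢ bᵢ - a b = aᵢ (bᵢ - b) + b (aᵢ - a)` -/
theorem tendsto_eLpNorm_mul_sub_mul [IsFiniteMeasure μ] {a : ι → α → ℝ} {a₀ : α → ℝ}
    {b : ι → α → ℝ} {b₀ : α → ℝ} {C : ℝ} (ha : ∀ i x, |a i x| ≤ C)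
    (ham : ∀ i, AEStronglyMeasurable (a i) μ) (ha₀ : AEStronglyMeasurable a₀ μ)
    (haa : Tendsto (fun i => eLpNorm (a i - a₀) 2 μ) l (𝓝 0))
    (hbm : ∀ i, AEStronglyMeasurable (b i) μ) (hb₀ : MemLp b₀ 2 μ)
    (hbb : Tendsto (fun i => eLpNorm (b i - b₀) 2 μ) l (𝓝 0)) :
    Tendsto (fun i => eLpNorm ((fun x => a i x * b i x) - fun x => a₀ x * b₀ x) 1 μ) l (𝓝 0) := by
  have hsub (i : ι) : AEStronglyMeasurable (b i - b₀) μ := (hbm i).sub hb₀.1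
  have hsub' (i : ι) : AEStronglyMeasurable (a i - a₀) μ := (ham i).sub ha₀
  have hfirst : Tendsto (fun i => eLpNorm (a i * (b i - b₀)) 1 μ) l (𝓝 0) := by
    refine tendsto_eLpNorm_zero_of_norm_le (fun i x => ?_)
      (tendsto_eLpNorm_mul_zero (memLp_const (p := 2) C) hsub hbb)
    simp only [Pi.mul_apply, norm_mul, Real.norm_eq_abs]
    exact mul_le_mul_of_nonneg_right ((ha i x).trans (le_abs_self C)) (abs_nonneg _)
  have hsecond : Tendsto (fun i => eLpNorm (b₀ * (a i - a₀)) 1 μ) l (𝓝 0) :=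
    tendsto_eLpNorm_mul_zero hb₀ hsub' haa
  refine (tendsto_eLpNorm_add_zero le_rfl (fun i => (ham i).mul (hsub i))
    (fun i => hb₀.1.mul (hsub' i)) hfirst hsecond).congr fun i => ?_
  congr 1
  ext x
  simp only [Pi.add_apply, Pi.mul_apply, Pi.sub_apply]
  ring

end Convergence

section ExpCutoff

/-- The function `e^{-r}` smoothly cut off near `r = -a`: it equals `1 / (e^r + e^{-a})`, and it
approximates `e^{-r}` from below by bounded functions as `a → ∞`. -/
def expCutoff (a r : ℝ) : ℝ := Real.exp (-r) * Real.sigmoid (r + a)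

/-- The opposite of the derivative of `expCutoff a`. -/
def expCutoffSlope (a r : ℝ) : ℝ := expCutoff a r * Real.sigmoid (r + a)

theorem expCutoff_nonneg (a r : ℝ) : 0 ≤ expCutoff a r :=
  mul_nonneg (Real.exp_pos _).le (Real.sigmoid_nonneg _)

theorem expCutoff_le_exp_neg (a r : ℝ) : expCutoff a r ≤ Real.exp (-r) :=
  mul_le_of_le_one_right (Real.exp_pos _).le (Real.sigmoid_le_one _)

theorem expCutoff_le_exp (a r : ℝ) : expCutoff a r ≤ Real.exp a := by
  have h : expCutoff a r = Real.exp a * Real.sigmoid (-(r + a)) := by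
    rw [expCutoff, ← Real.sigmoid_mul_rexp_neg, mul_left_comm, ← Real.exp_add, mul_comm]
    congr 2
    ring
  exact h.trans_le (mul_le_of_le_one_right (Real.exp_pos _).le (Real.sigmoid_le_one _))

theorem expCutoffSlope_nonneg (a r : ℝ) : 0 ≤ expCutoffSlope a r :=
  mul_nonneg (expCutoff_nonneg a r) (Real.sigmoid_nonneg _)

theorem expCutoffSlope_le (a r : ℝ) : expCutoffSlope a r ≤ expCutoff a r :=
  mul_le_of_le_one_right (expCutoff_nonneg a r) (Real.sigmoid_le_one _)

theorem expCutoffSlope_le_exp (a r : ℝ) : expCutoffSlope a r ≤ Real.exp a :=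
  (expCutoffSlope_le a r).trans (expCutoff_le_exp a r)

theorem abs_expCutoffSlope_le_exp_neg (a r : ℝ) : |expCutoffSlope a r| ≤ Real.exp (-r) :=
  (abs_of_nonneg (expCutoffSlope_nonneg a r)).trans_le
    ((expCutoffSlope_le a r).trans (expCutoff_le_exp_neg a r))

theorem hasDerivAt_sigmoid_add (a r : ℝ) :
    HasDerivAt (fun x => Real.sigmoid (x + a))
      (Real.sigmoid (r + a) * (1 - Real.sigmoid (r + a))) r :=
  (Real.hasDerivAt_sigmoid (r + a)).comp_add_const r a

theorem hasDerivAt_expCutoff (a r : ℝ) :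
    HasDerivAt (expCutoff a) (-expCutoffSlope a r) r := by
  refine ((hasDerivAt_neg r).exp.mul (hasDerivAt_sigmoid_add a r)).congr_deriv ?_
  simp only [expCutoffSlope, expCutoff]
  ring

theorem hasDerivAt_expCutoffSlope (a r : ℝ) :
    HasDerivAt (expCutoffSlope a) (expCutoffSlope a r * (1 - 2 * Real.sigmoid (r + a))) r := by
  refine ((hasDerivAt_expCutoff a r).mul (hasDerivAt_sigmoid_add a r)).congr_deriv ?_
  simp only [expCutoffSlope]
  ring

theorem lipschitzWith_expCutoffSlope (a : ℝ) :
    LipschitzWith (Real.exp a).toNNReal (expCutoffSlope a) := by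
  refine lipschitzWith_of_nnnorm_deriv_le
    (fun r => (hasDerivAt_expCutoffSlope a r).differentiableAt) fun r => ?_
  have hsigmoid : |1 - 2 * Real.sigmoid (r + a)| ≤ 1 := by
    rw [abs_le]
    constructor <;> linarith [Real.sigmoid_nonneg (r + a), Real.sigmoid_le_one (r + a)]
  rw [(hasDerivAt_expCutoffSlope a r).deriv, ← NNReal.coe_le_coe, coe_nnnorm, norm_mul,
    Real.norm_of_nonneg (expCutoffSlope_nonneg a r)]
  exact (mul_le_of_le_one_right (expCutoffSlope_nonneg a r) hsigmoid).trans
    ((expCutoffSlope_le_exp a r).trans (Real.le_coe_toNNReal _))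

theorem tendsto_sigmoid_add_atTop (r : ℝ) :
    Tendsto (fun a => Real.sigmoid (r + a)) atTop (𝓝 1) :=
  Real.tendsto_sigmoid_atTop.comp (tendsto_atTop_add_const_left _ r tendsto_id)

theorem tendsto_expCutoff (r : ℝ) :
    Tendsto (fun a => expCutoff a r) atTop (𝓝 (Real.exp (-r))) := by
  simpa only [expCutoff, mul_one] using (tendsto_sigmoid_add_atTop r).const_mul (Real.exp (-r))

theorem tendsto_expCutoffSlope (r : ℝ) :
    Tendsto (fun a => expCutoffSlope a r) atTop (𝓝 (Real.exp (-r))) := by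
  simpa only [expCutoffSlope, mul_one] using (tendsto_expCutoff r).mul (tendsto_sigmoid_add_atTop r)

end ExpCutoff

section Fomin

variable {E : Type*} [AddCommGroup E] [Module ℝ E] [TopologicalSpace E] [MeasurableSpace E]
  {μ : Measure E} {d : E} {β : E → ℝ}

theorem HasWeakLineDeriv.integrable_tilted [IsFiniteMeasure μ] {f f' : E → ℝ}
    (hexp : HasWeakLineDeriv μ d β (fun u => Real.exp (-f u)) (fun u => -Real.exp (-f u) * f' u))
    (hβ2 : MemLp β 2 μ) : Integrable (fun u => β u + f' u) (μ.tilted fun u => -f u) := by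
  rw [integrable_tilted_iff (hexp.memLp.integrable one_le_two)]
  refine ((hexp.memLp.integrable_mul hβ2).sub hexp.integrable_deriv).congr (.of_forall fun u => ?_)
  simp only [Pi.sub_apply, Pi.mul_apply, smul_eq_mul]
  ring

variable [OpensMeasurableSpace E]

/-- The constant directions `d₁`, `d₂` are a conjugate pair and the vector field is
`∂₂F d₁ - ∂₁F d₂`; its second-order contributions cancel because `G` is `∂₁∂₂F`. -/
theorem HasFominDivergence.integral_hamiltonian {d₁ d₂ : E} {β₁ β₂ F₁ F₂ G : E → ℝ}
    (h₁ : HasFominDivergence μ d₁ β₁) (h₂ : HasFominDivergence μ d₂ β₂)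
    (hF₁ : IsTestAlong d₂ F₁ G) (hF₂ : IsTestAlong d₁ F₂ G) :
    ∫ u, (F₁ u * β₂ u - F₂ u * β₁ u) ∂μ = 0 := by
  rw [integral_sub (hF₁.integrable_mul h₂.integrable) (hF₂.integrable_mul h₁.integrable),
    ← h₂.integral_deriv hF₁, ← h₁.integral_deriv hF₂, sub_self]

variable [IsFiniteMeasure μ]

theorem HasFominDivergence.hasWeakLineDeriv {F F' : E → ℝ} (hβ : HasFominDivergence μ d β)
    (hF : IsTestAlong d F F') : HasWeakLineDeriv μ d β F F' where
  memLp := hF.memLp 2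
  integrable_deriv := (hF.memLp_deriv 1).integrable le_rfl
  integral_eq_zero {G G'} hG := by
    have hGF := hG.mul hF
    calc ∫ u, ((G' u - G u * β u) * F u + G u * F' u) ∂μ
        = ∫ u, ((G' u * F u + G u * F' u) - G u * F u * β u) ∂μ := by
          congr with u
          ring
      _ = 0 := by
          rw [integral_sub ((hGF.memLp_deriv 1).integrable le_rfl)
            (hGF.integrable_mul hβ.integrable), hβ.integral_deriv hGF, sub_self]

theorem HasWeakLineDeriv.of_tendsto {ι : Type*} {l : Filter ι} [l.NeBot] {f f' : E → ℝ}
    {F F' : ι → E → ℝ} (hβ : MemLp β 2 μ) (hF : ∀ i, HasWeakLineDeriv μ d β (F i) (F' i))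
    (hf : MemLp f 2 μ) (hf' : Integrable f' μ)
    (hlim : Tendsto (fun i => eLpNorm (F i - f) 2 μ) l (𝓝 0))
    (hlim' : Tendsto (fun i => eLpNorm (F' i - f') 1 μ) l (𝓝 0)) :
    HasWeakLineDeriv μ d β f f' where
  memLp := hf
  integrable_deriv := hf'
  integral_eq_zero {G G'} hG := by
    have hk : MemLp (G' - G * β) 2 μ := (hG.memLp_deriv 2).sub (hβ.mul (hG.memLp ⊤))
    have hmeas (i : ι) : AEStronglyMeasurable (F i - f) μ := (hF i).memLp.1.sub hf.1
    have hmeas' (i : ι) : AEStronglyMeasurable (F' i - f') μ := (hF i).integrable_deriv.1.sub hf'.1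
    have hint {p p' : E → ℝ} (hp : MemLp p 2 μ) (hp' : Integrable p' μ) :
        Integrable ((G' - G * β) * p + G * p') μ :=
      (hk.integrable_mul hp).add (hG.integrable_mul hp')
    have key : Tendsto (fun i => ∫ u, ((G' - G * β) * F i + G * F' i) u ∂μ) l
        (𝓝 (∫ u, ((G' - G * β) * f + G * f') u ∂μ)) := by
      refine tendsto_integral_of_L1' _ (hint hf hf').1
        (.of_forall fun i => hint (hF i).memLp (hF i).integrable_deriv) ?_
      have hsum := tendsto_eLpNorm_add_zero le_rfl
        (fun i => hk.1.mul (hmeas i)) (fun i => (hG.memLp ⊤).1.mul (hmeas' i))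
        (tendsto_eLpNorm_mul_zero (r := 1) hk hmeas hlim)
        (tendsto_eLpNorm_mul_zero (hG.memLp ⊤) hmeas' hlim')
      refine hsum.congr fun i => ?_
      congr 1
      ring
    exact tendsto_nhds_unique key
      (tendsto_const_nhds.congr fun i => ((hF i).integral_eq_zero hG).symm)

/-- The approximants `ψ'(Fⱼ) Fⱼ'` converge only in `L¹`: `ψ'(Fⱼ) → ψ'(f)` in `L²` since `ψ'` is
Lipschitz, and `Fⱼ' → f'` in `L²`. -/
theorem HasSobolevLineDeriv.comp {f f' : E → ℝ} (hf : HasSobolevLineDeriv μ d f f')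
    (hβ : HasFominDivergence μ d β) (hβ2 : MemLp β 2 μ) {ψ ψ' : ℝ → ℝ} {C : ℝ} {C' K : ℝ≥0}
    (hψ : ∀ x, HasDerivAt ψ (ψ' x) x) (hC : ∀ x, |ψ x| ≤ C) (hC' : ∀ x, |ψ' x| ≤ C')
    (hK : LipschitzWith K ψ') :
    HasWeakLineDeriv μ d β (fun u => ψ (f u)) (fun u => ψ' (f u) * f' u) := by
  obtain ⟨F, F', htest, hF, hF'⟩ := hf.exists_approx
  have hψ_lip : LipschitzWith C' ψ :=
    lipschitzWith_of_nnnorm_deriv_le (fun x => (hψ x).differentiableAt) fun x => by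
      rw [(hψ x).deriv]
      exact hC' x
  have hmeas : AEStronglyMeasurable f μ := hf.memLp.1
  have hψf : MemLp (fun u => ψ (f u)) 2 μ :=
    .of_bound (hψ_lip.continuous.comp_aestronglyMeasurable hmeas) C (.of_forall fun _ => hC _)
  have hψf' : Integrable (fun u => ψ' (f u) * f' u) μ :=
    (hf.memLp_deriv.integrable one_le_two).bdd_mul
      (hK.continuous.comp_aestronglyMeasurable hmeas) (.of_forall fun _ => hC' _)
  refine .of_tendsto (l := atTop) hβ2
    (fun j => hβ.hasWeakLineDeriv ((htest j).comp hψ hK.continuous hC hC')) hψf hψf'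
    (tendsto_eLpNorm_comp_sub hψ_lip (fun j => ((htest j).memLp 2).1) hmeas hF) ?_
  exact tendsto_eLpNorm_mul_sub_mul (fun j u => hC' (F j u))
    (fun j => hK.continuous.comp_aestronglyMeasurable ((htest j).memLp 2).1)
    (hK.continuous.comp_aestronglyMeasurable hmeas)
    (tendsto_eLpNorm_comp_sub hK (fun j => ((htest j).memLp 2).1) hmeas hF)
    (fun j => ((htest j).memLp_deriv 2).1) hf.memLp_deriv hF'

theorem HasSobolevLineDeriv.exp_neg {f f' : E → ℝ} (hf : HasSobolevLineDeriv μ d f f')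
    (hβ : HasFominDivergence μ d β) (hβ2 : MemLp β 2 μ)
    (hexp : MemLp (fun u => Real.exp (-f u)) 2 μ) :
    HasWeakLineDeriv μ d β (fun u => Real.exp (-f u)) (fun u => -Real.exp (-f u) * f' u) where
  memLp := hexp
  integrable_deriv := hexp.neg.integrable_mul hf.memLp_deriv
  integral_eq_zero {G G'} hG := by
    have hcutoff (a : ℝ) : HasWeakLineDeriv μ d β (fun u => expCutoff a (f u))
        (fun u => -expCutoffSlope a (f u) * f' u) :=
      hf.comp hβ hβ2 (hasDerivAt_expCutoff a)
        (fun r => (abs_of_nonneg (expCutoff_nonneg a r)).trans_le (expCutoff_le_exp a r))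
        (fun r => by
          rw [abs_neg, abs_of_nonneg (expCutoffSlope_nonneg a r)]
          exact (expCutoffSlope_le_exp a r).trans (Real.le_coe_toNNReal _))
        (lipschitzWith_expCutoffSlope a).neg
    have hk : MemLp (fun u => G' u - G u * β u) 2 μ :=
      (hG.memLp_deriv 2).sub (hβ2.mul (hG.memLp ⊤))
    have hk' : MemLp (fun u => G u * f' u) 2 μ := hf.memLp_deriv.mul (hG.memLp ⊤)
    have hlim := tendsto_integral_filter_of_dominated_convergence (μ := μ) (l := atTop)
      (F := fun a u => (G' u - G u * β u) * expCutoff a (f u) +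
        G u * (-expCutoffSlope a (f u) * f' u))
      (f := fun u => (G' u - G u * β u) * Real.exp (-f u) + G u * (-Real.exp (-f u) * f' u))
      (fun u => (|G' u - G u * β u| + |G u * f' u|) * Real.exp (-f u)) ?_ ?_ ?_ ?_
    · exact tendsto_nhds_unique hlim
        (tendsto_const_nhds.congr fun a => ((hcutoff a).integral_eq_zero hG).symm)
    · exact .of_forall fun a => (hk.1.mul (hcutoff a).memLp.1).add
        (hG.integrable_mul (hcutoff a).integrable_deriv).1
    · refine .of_forall fun a => .of_forall fun u => (norm_add_le _ _).trans ?_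
      simp only [Real.norm_eq_abs, abs_mul, abs_neg, abs_of_nonneg (expCutoff_nonneg a (f u))]
      rw [add_mul, ← mul_assoc, mul_right_comm]
      gcongr
      exacts [expCutoff_le_exp_neg a _, abs_expCutoffSlope_le_exp_neg a _]
    · exact (hk.abs.add hk'.abs).integrable_mul hexp
    · exact .of_forall fun u => ((tendsto_expCutoff _).const_mul _).add
        (((tendsto_expCutoffSlope _).neg.mul_const _).const_mul _)

theorem HasWeakLineDeriv.hasFominDivergence_tilted {f f' : E → ℝ}
    (hexp : HasWeakLineDeriv μ d β (fun u => Real.exp (-f u)) (fun u => -Real.exp (-f u) * f' u))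
    (hβ2 : MemLp β 2 μ) :
    HasFominDivergence (μ.tilted fun u => -f u) d (fun u => β u + f' u) where
  integrable := hexp.integrable_tilted hβ2
  integral_deriv {G G'} hG := by
    have hint := hexp.integrable_tilted hβ2
    have hG' := (hG.memLp_deriv (μ := μ.tilted fun u => -f u) 1).integrable le_rfl
    rw [← sub_eq_zero, ← integral_sub hG' (hG.integrable_mul hint), integral_tilted]
    calc ∫ u, (Real.exp (-f u) / ∫ x, Real.exp (-f x) ∂μ) • (G' u - G u * (β u + f' u)) ∂μ
        = ∫ u, (∫ x, Real.exp (-f x) ∂μ)⁻¹ * ((G' u - G u * β u) * Real.exp (-f u) +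
            G u * (-Real.exp (-f u) * f' u)) ∂μ := by
          congr with u
          simp only [smul_eq_mul]
          ring
      _ = 0 := by rw [integral_const_mul, hexp.integral_eq_zero hG, mul_zero]

end Fomin

/-! ### Gaussian integration by parts -/

section Gaussian

open ProbabilityTheory

theorem hasDerivAt_gaussianPDFReal (m : ℝ) (v : ℝ≥0) (x : ℝ) :
    HasDerivAt (gaussianPDFReal m v) (-((x - m) / v) * gaussianPDFReal m v x) x := by
  have hexponent : HasDerivAt (fun x => -(x - m) ^ 2 / (2 * (v : ℝ))) (-((x - m) / v)) x := by
    refine ((((hasDerivAt_id x).sub_const m).pow 2).neg.div_const (2 * (v : ℝ))).congr_deriv ?_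
    simp only [id_eq, Nat.cast_ofNat, Nat.add_one_sub_one, pow_one, mul_one, neg_div]
    rw [mul_div_mul_left _ _ two_ne_zero]
  rw [gaussianPDFReal_def]
  refine (hexponent.exp.const_mul _).congr_deriv ?_
  ring

theorem hasFominDivergence_gaussianReal (m : ℝ) {v : ℝ≥0} (hv : v ≠ 0) :
    HasFominDivergence (gaussianReal m v) 1 (fun x => (x - m) / v) := by
  have hdiv : Integrable (fun x : ℝ => (x - m) / v) (gaussianReal m v) :=
    (((memLp_id_gaussianReal 1).integrable le_rfl).sub (integrable_const m)).div_const _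
  have integrable_mul_pdf {g : ℝ → ℝ} (hg : Integrable g (gaussianReal m v)) :
      Integrable (fun x => g x * gaussianPDFReal m v x) := by
    rw [gaussianReal_of_var_ne_zero _ hv,
      integrable_withDensity_iff_integrable_smul₀' (measurable_gaussianPDF m v).aemeasurable
        (ae_of_all _ fun x => by simp [gaussianPDF])] at hg
    simpa [toReal_gaussianPDF, mul_comm] using hg
  refine ⟨hdiv, fun {G G'} hG => ?_⟩
  have hparts := integral_mul_deriv_eq_deriv_mul_of_integrable
    (fun x _ => hG.hasDerivAt x) (fun x _ => hasDerivAt_gaussianPDFReal m v x)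
    ((integrable_mul_pdf (hG.integrable_mul hdiv).neg).congr
      (.of_forall fun x => by simp only [Pi.neg_apply, Pi.mul_apply]; ring))
    (integrable_mul_pdf ((hG.memLp_deriv 1).integrable le_rfl))
    (integrable_mul_pdf ((hG.memLp 1).integrable le_rfl))
  rw [integral_gaussianReal_eq_integral_smul hv, integral_gaussianReal_eq_integral_smul hv]
  calc ∫ x, gaussianPDFReal m v x • G' x
      = -∫ x, G x * (-((x - m) / v) * gaussianPDFReal m v x) := by
        simp only [hparts, neg_neg, smul_eq_mul, mul_comm]
    _ = ∫ x, gaussianPDFReal m v x • (G x * ((x - m) / v)) := by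
        rw [← integral_neg]
        congr with x
        simp only [smul_eq_mul]
        ring

variable {E : Type*} [NormedAddCommGroup E] [InnerProductSpace ℝ E]

/-- Replaces the component of `u` along `d`, as measured by the functional `⟪ξ, ·⟫`, by `r`. -/
def resample (ξ d : E) (p : ℝ × E) : E := (p.2 - ⟪ξ, p.2⟫_ℝ • d) + p.1 • d

theorem continuous_resample (ξ d : E) : Continuous (resample ξ d) := by
  unfold resample
  fun_prop

theorem inner_resample {ξ d : E} (hd : ⟪ξ, d⟫_ℝ = 1) (p : ℝ × E) : ⟪ξ, resample ξ d p⟫_ℝ = p.1 := by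
  simp [resample, inner_add_right, inner_sub_right, inner_smul_right, hd]

theorem resample_inner (ξ d η : E) (p : ℝ × E) :
    ⟪resample ξ d p, η⟫_ℝ = p.1 * ⟪d, η⟫_ℝ + ⟪p.2, η - ⟪d, η⟫_ℝ • ξ⟫_ℝ := by
  simp only [resample, inner_add_left, inner_sub_left, inner_sub_right, real_inner_smul_left,
    real_inner_smul_right, real_inner_comm ξ]
  ring

theorem inner_map_sub_smul {Q : E →ₗ[ℝ] E} (hQ : Q.IsSymmetric) {ξ d : E} {v : ℝ}
    (hd : ⟪ξ, d⟫_ℝ = 1) (hξ : Q ξ = v • d) (η : E) :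
    ⟪η - ⟪d, η⟫_ℝ • ξ, Q (η - ⟪d, η⟫_ℝ • ξ)⟫_ℝ = ⟪η, Q η⟫_ℝ - v * ⟪d, η⟫_ℝ ^ 2 := by
  have hcross : ⟪ξ, Q η⟫_ℝ = v * ⟪d, η⟫_ℝ := by rw [← hQ, hξ, real_inner_smul_left]
  simp only [map_sub, map_smul, inner_sub_left, inner_sub_right, real_inner_smul_left,
    real_inner_smul_right, hξ, hcross, hd, real_inner_comm d η]
  ring

variable [CompleteSpace E] [SecondCountableTopology E] [MeasurableSpace E] [BorelSpace E]
  {ν : Measure E} {Q : E →ₗ[ℝ] E} {ξ d : E} {v : ℝ≥0}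

/-- Under a centred Gaussian measure with covariance `Q`, the functional `⟪ξ, ·⟫` is independent of
the complementary component `u - ⟪ξ, u⟫ d` as soon as `Q ξ` is proportional to `d`. -/
theorem measurePreserving_resample [IsFiniteMeasure ν]
    (hν : ∀ η, charFun ν η = exp (-(1 / 2) * ⟪η, Q η⟫_ℝ)) (hQ : Q.IsSymmetric)
    (hd : ⟪ξ, d⟫_ℝ = 1) (hξ : Q ξ = (v : ℝ) • d) :
    MeasurePreserving (resample ξ d) ((gaussianReal 0 v).prod ν) ν := by
  have hmeas := (continuous_resample ξ d).measurable
  refine ⟨hmeas, Measure.ext_of_charFun (funext fun η => ?_)⟩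
  calc charFun (((gaussianReal 0 v).prod ν).map (resample ξ d)) η
      = ∫ p, exp (⟪d, η⟫_ℝ * p.1 * I) * exp (⟪p.2, η - ⟪d, η⟫_ℝ • ξ⟫_ℝ * I)
          ∂(gaussianReal 0 v).prod ν := by
        rw [charFun_apply, integral_map hmeas.aemeasurable (by fun_prop)]
        congr with p
        rw [resample_inner, ← exp_add, ← add_mul]
        push_cast
        ring_nf
    _ = charFun (gaussianReal 0 v) ⟪d, η⟫_ℝ * charFun ν (η - ⟪d, η⟫_ℝ • ξ) := by
        rw [integral_prod_mul (fun r : ℝ => exp (⟪d, η⟫_ℝ * r * I))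
          (fun u => exp (⟪u, η - ⟪d, η⟫_ℝ • ξ⟫_ℝ * I)), charFun_apply_real, charFun_apply]
    _ = charFun ν η := by
        rw [charFun_gaussianReal, hν, hν, inner_map_sub_smul hQ hd hξ, ← exp_add]
        congr 1
        push_cast
        ring

variable [IsProbabilityMeasure ν]

theorem measurePreserving_inner (hν : ∀ η, charFun ν η = exp (-(1 / 2) * ⟪η, Q η⟫_ℝ))
    (hQ : Q.IsSymmetric) (hd : ⟪ξ, d⟫_ℝ = 1) (hξ : Q ξ = (v : ℝ) • d) :
    MeasurePreserving (fun u => ⟪ξ, u⟫_ℝ) ν (gaussianReal 0 v) := by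
  have hinner : Measurable fun u => ⟪ξ, u⟫_ℝ := by fun_prop
  have hfst : (fun u => ⟪ξ, u⟫_ℝ) ∘ resample ξ d = Prod.fst := funext (inner_resample hd)
  have hres := measurePreserving_resample hν hQ hd hξ
  refine ⟨hinner, ?_⟩
  rw [← hres.map_eq, Measure.map_map hinner hres.measurable, hfst, measurePreserving_fst.map_eq]

theorem memLp_inner_of_charFun_eq (hν : ∀ η, charFun ν η = exp (-(1 / 2) * ⟪η, Q η⟫_ℝ))
    (hQ : Q.IsSymmetric) (hd : ⟪ξ, d⟫_ℝ = 1) (hξ : Q ξ = (v : ℝ) • d) (p : ℝ≥0) :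
    MemLp (fun u => ⟪ξ, u⟫_ℝ) p ν :=
  (memLp_id_gaussianReal p).comp_measurePreserving (measurePreserving_inner hν hQ hd hξ)

theorem hasFominDivergence_of_charFun_eq (hν : ∀ η, charFun ν η = exp (-(1 / 2) * ⟪η, Q η⟫_ℝ))
    (hQ : Q.IsSymmetric) (hd : ⟪ξ, d⟫_ℝ = 1) (hξ : Q ξ = (v : ℝ) • d) (hv : v ≠ 0) :
    HasFominDivergence ν d (fun u => ⟪ξ, u⟫_ℝ / v) := by
  have hβ : Integrable (fun u => ⟪ξ, u⟫_ℝ / v) ν :=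
    ((memLp_inner_of_charFun_eq hν hQ hd hξ 1).integrable le_rfl).div_const _
  refine ⟨hβ, fun {G G'} hG => ?_⟩
  have hres := measurePreserving_resample hν hQ hd hξ
  have integral_eq {f : E → ℝ} (hf : Integrable f ν) :
      ∫ u, f u ∂ν = ∫ u, ∫ r, f (resample ξ d (r, u)) ∂gaussianReal 0 v ∂ν := by
    rw [← integral_prod_symm (fun p => f (resample ξ d p)) (hres.integrable_comp_of_integrable hf),
      ← integral_map hres.measurable.aemeasurable (hres.map_eq.symm ▸ hf.1), hres.map_eq]
  rw [integral_eq ((hG.memLp_deriv 1).integrable le_rfl), integral_eq (hG.integrable_mul hβ)]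
  congr with u
  simp only [inner_resample hd]
  simpa only [sub_zero, resample] using (hasFominDivergence_gaussianReal 0 hv).integral_deriv
    (hG.comp_line (u - ⟪ξ, u⟫_ℝ • d))

end Gaussian

namespace SpectralSetup

variable {H : Type*} [NormedAddCommGroup H] [InnerProductSpace ℂ H] [CompleteSpace H]

/-! ### Coordinates and diagonal operators on `H^{-s}` -/

section Coordinates

variable (S : SpectralSetup H) (s : ℝ≥0)

/-- The dense inclusion `H ⊂ H^{-s}` as a continuous linear map. -/
def embL : H →L[ℂ] S.Hneg s :=
  LinearMap.mkContinuous
    { toFun := S.emb s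
      map_add' := fun x y => Completion.coe_add (S.toPre s x) (S.toPre s y)
      map_smul' := fun a x => Completion.coe_smul a (S.toPre s x) }
    ‖S.diag (S.negPow (s / 2)) (S.negPow_bdd _)‖
    fun x => (Completion.norm_coe _).trans_le
      (ContinuousLinearMap.le_opNorm (S.diag (S.negPow (s / 2)) (S.negPow_bdd _)) x)

theorem embL_apply (x : H) : S.embL s x = S.emb s x := rfl

theorem denseRange_embL : DenseRange (S.embL s) :=
  Completion.denseRange_coe.comp (S.toPre s).surjective.denseRange (Completion.continuous_coe _)

theorem dense_span_emb_e :
    Dense (Submodule.span ℂ (Set.range fun k => S.emb s (S.e k)) : Set (S.Hneg s)) := by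
  have h := (S.denseRange_embL s).topologicalClosure_map_submodule S.e.dense_span
  rwa [Submodule.map_span, ← Set.range_comp, ← Submodule.dense_iff_topologicalClosure_eq_top] at h

theorem ext_emb_e {F : Type*} [TopologicalSpace F] [AddCommMonoid F] [Module ℂ F] [T2Space F]
    {f g : S.Hneg s →L[ℂ] F} (hfg : ∀ k, f (S.emb s (S.e k)) = g (S.emb s (S.e k))) : f = g :=
  ContinuousLinearMap.ext_on (S.dense_span_emb_e s) (Set.forall_mem_range.2 hfg)

instance : SecondCountableTopology (S.Hneg s) := by
  have hsep := ((Set.countable_range fun k => S.emb s (S.e k)).isSeparable.span (R := ℂ)).closure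
  rw [(S.dense_span_emb_e s).closure_eq, TopologicalSpace.isSeparable_univ_iff] at hsep
  exact UniformSpace.secondCountable_of_separable _

/-- The coordinate `u ↦ ⟨eₖ, u⟩` on `H^{-s}` as a continuous linear form. -/
def coordL (k : ℕ) : S.Hneg s →L[ℂ] ℂ :=
  ((S.lam k ^ (s : ℝ) : ℝ) : ℂ) • innerSL ℂ (S.emb s (S.e k))

theorem coordL_apply (k : ℕ) (u : S.Hneg s) : S.coordL s k u = S.coord s u k := rfl

/-- The first `n` coordinates on `H^{-s}`, i.e. the arguments of a cylindrical function, as a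
continuous linear map. -/
def coordsL (n : ℕ) : S.Hneg s →L[ℂ] (Fin n → ℂ) := .pi fun k => S.coordL s k

theorem coordsL_apply (n : ℕ) (u : S.Hneg s) : S.coordsL s n u = fun k : Fin n => S.coord s u k :=
  rfl

theorem coord_emb_e (j k : ℕ) : S.coord s (S.emb s (S.e j)) k = if k = j then 1 else 0 := by
  rw [coord_emb, orthonormal_iff_ite.1 S.e.orthonormal]

variable {m m' : ℕ → ℂ} (hm : ∃ C : ℝ, ∀ k, ‖m k‖ ≤ C) (hm' : ∃ C : ℝ, ∀ k, ‖m' k‖ ≤ C)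

theorem diagNeg_emb_e (k : ℕ) :
    S.diagNeg s m hm (S.emb s (S.e k)) = m k • S.emb s (S.e k) := by
  have hdiag : S.diag m hm (S.e k) = m k • S.e k := by
    apply S.e.repr.injective
    ext j
    rw [repr_diag, map_smul, lp.coeFn_smul, Pi.smul_apply, smul_eq_mul, S.e.repr_self]
    rcases eq_or_ne j k with rfl | hjk
    · rfl
    · simp [hjk]
  calc S.diagNeg s m hm (S.emb s (S.e k)) = S.embL s (S.diag m hm (S.e k)) :=
        ContinuousLinearMap.completion_apply_coe _ _
    _ = m k • S.emb s (S.e k) := by rw [hdiag, map_smul, embL_apply]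

theorem coord_diagNeg (u : S.Hneg s) (k : ℕ) :
    S.coord s (S.diagNeg s m hm u) k = m k * S.coord s u k := by
  have h : S.coordL s k ∘L S.diagNeg s m hm = m k • S.coordL s k := S.ext_emb_e s fun j => by
    rw [ContinuousLinearMap.comp_apply, diagNeg_emb_e, map_smul, smul_apply,
      coordL_apply, coord_emb_e]
    split_ifs with hkj
    · rw [hkj]
    · simp only [smul_zero]
  exact DFunLike.congr_fun h u

theorem inner_emb_e_diagNeg (u : S.Hneg s) (k : ℕ) :
    ⟪S.emb s (S.e k), S.diagNeg s m hm u⟫_ℂ = m k * ⟪S.emb s (S.e k), u⟫_ℂ := by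
  have hpow : ((S.lam k ^ (s : ℝ) : ℝ) : ℂ) ≠ 0 :=
    ofReal_ne_zero.2 (Real.rpow_pos_of_pos (S.lam_pos k) _).ne'
  have h := S.coord_diagNeg s hm u k
  rw [coord, coord, mul_left_comm] at h
  exact mul_left_cancel₀ hpow h

theorem inner_diagNeg_left (hconj : ∀ k, m' k = conj (m k)) (u v : S.Hneg s) :
    ⟪S.diagNeg s m hm u, v⟫_ℂ = ⟪u, S.diagNeg s m' hm' v⟫_ℂ := by
  have h : innerSL ℂ (S.diagNeg s m hm u) = innerSL ℂ u ∘L S.diagNeg s m' hm' :=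
    S.ext_emb_e s fun k => by
      rw [innerSL_apply_apply, ContinuousLinearMap.comp_apply, innerSL_apply_apply, diagNeg_emb_e,
        inner_smul_right, ← inner_conj_symm, inner_emb_e_diagNeg, map_mul, inner_conj_symm, hconj]
  exact DFunLike.congr_fun h v

end Coordinates

/-! ### The flow `e^{itA}` on `H^{-s}` -/

section Flow

variable (S : SpectralSetup H)

theorem norm_expMul (t : ℝ) (k : ℕ) : ‖S.expMul t k‖ = 1 := by
  rw [expMul, ← ofReal_mul, norm_exp_ofReal_mul_I]

theorem conj_expMul (t : ℝ) (k : ℕ) : conj (S.expMul t k) = S.expMul (-t) k := by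
  simp [expMul, ← exp_conj]

theorem hasDerivAt_expMul (t : ℝ) (k : ℕ) :
    HasDerivAt (fun τ : ℝ => S.expMul τ k) (I * S.lam k * S.expMul t k) t := by
  have h := ((ofRealCLM.hasDerivAt (x := t)).mul_const (S.lam k : ℂ)).mul_const I
  refine h.cexp.congr_deriv ?_
  simp only [ofRealCLM_apply, ofReal_one, one_mul, expMul]
  ring

variable (s : ℝ≥0)

theorem flow_emb_e (t : ℝ) (k : ℕ) :
    S.flow s t (S.emb s (S.e k)) = S.expMul t k • S.emb s (S.e k) :=
  S.diagNeg_emb_e s _ k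

theorem coord_flow (t : ℝ) (u : S.Hneg s) (k : ℕ) :
    S.coord s (S.flow s t u) k = S.expMul t k * S.coord s u k :=
  S.coord_diagNeg s _ u k

theorem flow_neg_flow (t : ℝ) (u : S.Hneg s) : S.flow s (-t) (S.flow s t u) = u := by
  have h : S.flow s (-t) ∘L S.flow s t = .id ℂ _ := S.ext_emb_e s fun k => by
    rw [ContinuousLinearMap.comp_apply, flow_emb_e, map_smul, flow_emb_e, smul_smul, ← conj_expMul,
      mul_conj', norm_expMul, ofReal_one, one_pow, one_smul, ContinuousLinearMap.id_apply]
  exact DFunLike.congr_fun h u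

theorem norm_flow (t : ℝ) (u : S.Hneg s) : ‖S.flow s t u‖ = ‖u‖ := by
  rw [norm_eq_sqrt_re_inner (𝕜 := ℂ), norm_eq_sqrt_re_inner (𝕜 := ℂ) u]
  congr 2
  calc ⟪S.flow s t u, S.flow s t u⟫_ℂ = ⟪u, S.flow s (-t) (S.flow s t u)⟫_ℂ :=
        S.inner_diagNeg_left s _ _ (fun k => (S.conj_expMul t k).symm) _ _
    _ = ⟪u, u⟫_ℂ := by rw [flow_neg_flow]

theorem measurableEmbedding_flow (t : ℝ) : MeasurableEmbedding (S.flow s t) :=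
  Homeomorph.measurableEmbedding
    { toFun := S.flow s t
      invFun := S.flow s (-t)
      left_inv := S.flow_neg_flow s t
      right_inv := fun u => by simpa using S.flow_neg_flow s (-t) u }

theorem continuous_flow (u : S.Hneg s) : Continuous fun t => S.flow s t u := by
  have hspan : ∀ v ∈ Submodule.span ℂ (Set.range fun k => S.emb s (S.e k)),
      Continuous fun t => S.flow s t v := fun v hv => by
    induction hv using Submodule.span_induction with
    | mem v hv =>
      obtain ⟨k, rfl⟩ := hv
      simp only [flow_emb_e, expMul]
      fun_prop
    | zero => simpa only [map_zero] using continuous_const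
    | add v w _ _ hv hw => simpa only [map_add] using hv.fun_add hw
    | smul a v _ hv => simpa only [map_smul] using hv.fun_const_smul a
  -- The flow is isometric, so approximating `u` approximates its orbit uniformly in time.
  refine continuous_of_uniform_approx_of_continuous fun V hV => ?_
  obtain ⟨ε, hε, hεV⟩ := Metric.mem_uniformity_dist.1 hV
  obtain ⟨v, hv, hd⟩ := (S.dense_span_emb_e s).exists_dist_lt u hε
  refine ⟨fun t => S.flow s t v, hspan v hv, fun t => hεV ?_⟩
  rwa [dist_eq_norm, ← map_sub, norm_flow, ← dist_eq_norm]

end Flow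

/-! ### Integration by parts for the Gaussian measure -/

section Directions

/-- The inner product `⟨·,·⟩_{H^{-s}_ℝ} = Re ⟨·,·⟩_{H^{-s}}`. -/
instance (S : SpectralSetup H) (s : ℝ≥0) : InnerProductSpace ℝ (S.Hneg s) :=
  InnerProductSpace.complexToReal

variable (S : SpectralSetup H) (s : ℝ≥0)

/-- The direction `c eₖ` in `H^{-s}`; the real orthonormal basis of `H` consists of the `eₖ` and
the `i eₖ`, so `c` is `1` or `I` in all uses. -/
def dir (k : ℕ) (c : ℂ) : S.Hneg s := c • S.emb s (S.e k)

/-- The real coordinate `u ↦ ⟨u, c eₖ⟩` on `H^{-s}`, for the real duality pairing. -/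
def rcoord (k : ℕ) (c : ℂ) : S.Hneg s →L[ℝ] ℝ :=
  reCLM ∘L (conj c • S.coordL s k).restrictScalars ℝ

theorem rcoord_apply (k : ℕ) (c : ℂ) (u : S.Hneg s) :
    S.rcoord s k c u = (conj c * S.coord s u k).re := rfl

theorem coordsL_dir {n : ℕ} (k : Fin n) (c : ℂ) :
    S.coordsL s n (S.dir s k c) = Pi.single k c := by
  funext j
  rw [dir, map_smul, coordsL_apply, Pi.smul_apply, coord_emb_e, Pi.single_apply]
  simp only [Fin.val_inj, smul_eq_mul, mul_ite, mul_one, mul_zero]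

theorem rcoord_dir (k : ℕ) {c : ℂ} (hc : ‖c‖ = 1) : S.rcoord s k c (S.dir s k c) = 1 := by
  rw [rcoord_apply, dir, ← coordL_apply, map_smul, coordL_apply, coord_emb_e, if_pos rfl,
    smul_eq_mul, mul_one, conj_mul', hc, ofReal_one, one_pow, one_re]

theorem inner_smul_dir (k : ℕ) (c : ℂ) (u : S.Hneg s) :
    ⟪S.lam k ^ (s : ℝ) • S.dir s k c, u⟫_ℝ = S.rcoord s k c u := by
  rw [real_inner_smul_left, real_inner_eq_re_inner ℂ, dir, inner_smul_left, rcoord_apply, coord,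
    mul_left_comm]
  exact (re_ofReal_mul _ _).symm

/-- The covariance operator `A^{-(s+1)}` of the Gaussian measure, as a real operator on `H^{-s}`. -/
def covariance : S.Hneg s →ₗ[ℝ] S.Hneg s := (S.powNeg s (s + 1)).toLinearMap.restrictScalars ℝ

theorem covariance_smul_dir (k : ℕ) (c : ℂ) :
    S.covariance s (S.lam k ^ (s : ℝ) • S.dir s k c) =
      ((S.lam k)⁻¹.toNNReal : ℝ) • S.dir s k c := by
  have hpow : S.lam k ^ (s : ℝ) * S.lam k ^ (-((s + 1 : ℝ≥0) : ℝ)) = (S.lam k)⁻¹ := by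
    rw [← Real.rpow_add (S.lam_pos k), ← Real.rpow_neg_one]
    congr 1
    push_cast
    ring
  have hdir : S.powNeg s (s + 1) (S.dir s k c) =
      S.lam k ^ (-((s + 1 : ℝ≥0) : ℝ)) • S.dir s k c := by
    rw [dir, map_smul, powNeg, diagNeg_emb_e, smul_comm c, negPow, coe_smul]
  rw [Real.coe_toNNReal _ (inv_pos.2 (S.lam_pos k)).le, ← hpow, mul_smul, ← hdir, map_smul]
  rfl

theorem isSymmetric_covariance : (S.covariance s).IsSymmetric := fun u v => by
  rw [real_inner_eq_re_inner ℂ, real_inner_eq_re_inner ℂ]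
  exact congrArg re (S.inner_diagNeg_left s _ _ (fun _ => (conj_ofReal _).symm) u v)

end Directions

namespace IsGaussian

variable {S : SpectralSetup H} {s : ℝ≥0} {ν : Measure (S.Hneg s)}

theorem charFun_eq (hν : S.IsGaussian s ν) (ξ : S.Hneg s) :
    charFun ν ξ = exp (-(1 / 2) * ⟪ξ, S.covariance s ξ⟫_ℝ) := by
  simp only [charFun_apply, real_inner_eq_re_inner ℂ, mul_comm _ I]
  exact hν.2 ξ

theorem memLp_rcoord (hν : S.IsGaussian s ν) (k : ℕ) {c : ℂ} (hc : ‖c‖ = 1) (p : ℝ≥0) :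
    MemLp (S.rcoord s k c) p ν := by
  have := hν.1
  have h := memLp_inner_of_charFun_eq hν.charFun_eq (S.isSymmetric_covariance s)
    ((S.inner_smul_dir s k c _).trans (S.rcoord_dir s k hc)) (S.covariance_smul_dir s k c) p
  simpa only [inner_smul_dir] using h

theorem hasFominDivergence (hν : S.IsGaussian s ν) (k : ℕ) {c : ℂ} (hc : ‖c‖ = 1) :
    HasFominDivergence ν (S.dir s k c) (fun u => S.lam k * S.rcoord s k c u) := by
  have := hν.1
  have hlam := inv_pos.2 (S.lam_pos k)
  have h := hasFominDivergence_of_charFun_eq hν.charFun_eq (S.isSymmetric_covariance s)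
    ((S.inner_smul_dir s k c _).trans (S.rcoord_dir s k hc)) (S.covariance_smul_dir s k c)
    (Real.toNNReal_pos.2 hlam).ne'
  simpa only [inner_smul_dir, Real.coe_toNNReal _ hlam.le, div_inv_eq_mul, mul_comm] using h

end IsGaussian

/-! ### Cylindrical functions -/

namespace IsCbInfty

variable {n : ℕ} {φ : (Fin n → ℂ) → ℝ}

theorem differentiable (hφ : IsCbInfty φ) : Differentiable ℝ φ :=
  hφ.1.differentiable (by simp)

theorem continuous_fderiv (hφ : IsCbInfty φ) : Continuous (fderiv ℝ φ) :=
  hφ.1.continuous_fderiv (by simp)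

theorem bounded (hφ : IsCbInfty φ) : ∃ C, ∀ z, |φ z| ≤ C := by
  simpa only [norm_iteratedFDeriv_zero, Real.norm_eq_abs] using hφ.2 0

theorem fderiv_bounded (hφ : IsCbInfty φ) : ∃ C, ∀ z, ‖fderiv ℝ φ z‖ ≤ C := by
  simpa only [norm_iteratedFDeriv_one] using hφ.2 1

theorem fderiv_apply (hφ : IsCbInfty φ) (a : Fin n → ℂ) : IsCbInfty fun z => fderiv ℝ φ z a := by
  have hφ' : ContDiff ℝ ∞ (fderiv ℝ φ) := hφ.1.fderiv_right (by simp)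
  refine ⟨hφ'.clm_apply contDiff_const, fun m => ?_⟩
  obtain ⟨C, hC⟩ := hφ.2 (m + 1)
  refine ⟨‖a‖ * C, fun z => ?_⟩
  refine (norm_iteratedFDeriv_clm_apply_const hφ'.contDiffAt (mod_cast le_top)).trans ?_
  rw [norm_iteratedFDeriv_fderiv]
  gcongr
  exact hC z

theorem comp_clm {m : ℕ} (hφ : IsCbInfty φ) (L : (Fin m → ℂ) →L[ℝ] (Fin n → ℂ)) :
    IsCbInfty (φ ∘ L) := by
  refine ⟨hφ.1.comp L.contDiff, fun j => ?_⟩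
  obtain ⟨C, hC⟩ := hφ.2 j
  refine ⟨C * ∏ _i : Fin j, ‖L‖, fun z => ?_⟩
  rw [L.iteratedFDeriv_comp_right (hφ.1.of_le (mod_cast le_top)) z le_rfl]
  refine (ContinuousMultilinearMap.norm_compContinuousLinearMap_le _ _).trans ?_
  gcongr
  exact hC _

theorem isTestAlong {E : Type*} [AddCommGroup E] [Module ℝ E] [TopologicalSpace E]
    (hφ : IsCbInfty φ) (L : E →L[ℝ] (Fin n → ℂ)) (d : E) :
    IsTestAlong d (fun u => φ (L u)) (fun u => fderiv ℝ φ (L u) (L d)) where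
  continuous := hφ.1.continuous.comp L.continuous
  continuous_deriv := (hφ.continuous_fderiv.comp L.continuous).clm_apply continuous_const
  bounded := hφ.bounded.imp fun _ hC _ => hC _
  deriv_bounded := (hφ.fderiv_apply (L d)).bounded.imp fun _ hC _ => hC _
  hasLineDerivAt u := by
    have h := (hφ.differentiable (L u)).hasFDerivAt.hasLineDerivAt (L d)
    simpa only [HasLineDerivAt, map_add, map_smul] using h

theorem fderiv_fderiv_apply_comm (hφ : IsCbInfty φ) (a b z : Fin n → ℂ) :
    fderiv ℝ (fun w => fderiv ℝ φ w a) z b = fderiv ℝ (fun w => fderiv ℝ φ w b) z a := by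
  have hd : DifferentiableAt ℝ (fderiv ℝ φ) z :=
    (hφ.1.fderiv_right (m := ∞) (by simp)).differentiable (by simp) z
  have hsymm : IsSymmSndFDerivAt ℝ φ z := hφ.1.contDiffAt.isSymmSndFDerivAt <| by
    rw [minSmoothness_of_isRCLikeNormedField]
    exact WithTop.coe_le_coe.2 (le_top : (2 : ℕ∞) ≤ ⊤)
  rw [fderiv_clm_apply hd (differentiableAt_const _),
    fderiv_clm_apply hd (differentiableAt_const _)]
  simpa using hsymm.eq b a

end IsCbInfty

section Gradient

theorem apply_eq_sum_single_one_add_single_I {n : ℕ} (L : (Fin n → ℂ) →L[ℝ] ℝ) (a : Fin n → ℂ) :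
    L a = ∑ k, ((a k).re * L (Pi.single k 1) + (a k).im * L (Pi.single k I)) := by
  have hsingle (k : Fin n) : (Pi.single k (a k) : Fin n → ℂ) =
      (a k).re • (Pi.single k 1 : Fin n → ℂ) + (a k).im • (Pi.single k I : Fin n → ℂ) := by
    rw [← Pi.single_smul, ← Pi.single_smul, ← Pi.single_add]
    simp
  conv_lhs => rw [← Finset.univ_sum_single a]
  simp only [hsingle, map_sum, map_add, map_smul, smul_eq_mul]

variable (S : SpectralSetup H) (s : ℝ≥0) {n : ℕ} (φ : (Fin n → ℂ) → ℝ) (u : S.Hneg s)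

theorem inner_e_cylGrad (j : Fin n) :
    ⟪S.e j, S.cylGrad s φ u⟫_ℂ =
      fderiv ℝ φ (S.coordsL s n u) (Pi.single j 1) +
        fderiv ℝ φ (S.coordsL s n u) (Pi.single j I) * I := by
  simp [cylGrad, coordsL_apply, orthonormal_iff_ite.1 S.e.orthonormal, Fin.val_inj,
    Finset.sum_add_distrib]

theorem inner_e_cylGrad_of_le {j : ℕ} (hj : n ≤ j) : ⟪S.e j, S.cylGrad s φ u⟫_ℂ = 0 := by
  have hne (k : Fin n) : j ≠ k := (k.2.trans_le hj).ne'
  simp [cylGrad, orthonormal_iff_ite.1 S.e.orthonormal, hne]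

theorem pairing_cylGrad (a : ℕ → ℂ) :
    S.pairing a (S.cylGrad s φ u) = fderiv ℝ φ (S.coordsL s n u) (fun k => a k) := by
  rw [pairing, tsum_eq_sum (s := Finset.range n), apply_eq_sum_single_one_add_single_I,
    Finset.sum_range]
  · refine Finset.sum_congr rfl fun k _ => ?_
    rw [inner_e_cylGrad]
    simp
    ring
  · intro j hj
    rw [inner_e_cylGrad_of_le S s φ u (by simpa using hj), map_zero, zero_mul, zero_re]

theorem rcoord_emb (k : ℕ) (c : ℂ) (x : H) :
    S.rcoord s k c (S.emb s x) = S.pairing (S.coord s (S.dir s k c)) x := by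
  have hdir (j : ℕ) : S.coord s (S.dir s k c) j = if j = k then c else 0 := by
    rw [dir, ← coordL_apply, map_smul, coordL_apply, coord_emb_e, smul_eq_mul, mul_ite, mul_one,
      mul_zero]
  rw [rcoord_apply, coord_emb, pairing, tsum_eq_single k]
  · rw [hdir, if_pos rfl, ← conj_re, map_mul, conj_conj, mul_comm]
  · intro j hj
    rw [hdir, if_neg hj, mul_zero, zero_re]

theorem rcoord_emb_cylGrad (k : ℕ) (c : ℂ) :
    S.rcoord s k c (S.emb s (S.cylGrad s φ u)) =
      fderiv ℝ φ (S.coordsL s n u) (S.coordsL s n (S.dir s k c)) := by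
  rw [rcoord_emb, pairing_cylGrad, S.coordsL_apply s n (S.dir s k c)]

end Gradient

theorem IsMalliavinDeriv.hasSobolevLineDeriv {S : SpectralSetup H} {s : ℝ≥0}
    {ν : Measure (S.Hneg s)} {h : S.Hneg s → ℝ} {g : S.Hneg s → S.Hneg s}
    (hh : S.IsMalliavinDeriv s ν h g) (k : ℕ) (c : ℂ) :
    HasSobolevLineDeriv ν (S.dir s k c) h (fun u => S.rcoord s k c (g u)) where
  memLp := hh.1
  memLp_deriv := (S.rcoord s k c).comp_memLp' hh.2.1
  exists_approx := by
    obtain ⟨-, -, n, φ, hφ, hlim, hlim'⟩ := hh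
    refine ⟨fun j => S.cyl s (φ j), fun j u => S.rcoord s k c (S.emb s (S.cylGrad s (φ j) u)),
      fun j => ?_, hlim, ?_⟩
    · simp only [rcoord_emb_cylGrad]
      exact (hφ j).isTestAlong ((S.coordsL s (n j)).restrictScalars ℝ) (S.dir s k c)
    · simpa only [map_sub, Pi.sub_def] using tendsto_eLpNorm_clm_comp_zero (S.rcoord s k c) hlim'

end SpectralSetup

/-! ### The Gibbs measure -/

theorem integrable_tilted_of_memLp_two {α E : Type*} [MeasurableSpace α] {μ : Measure α}
    [IsFiniteMeasure μ] [NormedAddCommGroup E] [NormedSpace ℝ E] {f : α → ℝ} {g : α → E}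
    (hexp : MemLp (fun x => Real.exp (f x)) 2 μ) (hg : MemLp g 2 μ) :
    Integrable g (μ.tilted f) :=
  (integrable_tilted_iff (hexp.integrable one_le_two) g).2
    (memLp_one_iff_integrable.1 (hg.smul hexp))

namespace SpectralSetup

variable {H : Type*} [NormedAddCommGroup H] [InnerProductSpace ℂ H] [CompleteSpace H]

section Gibbs

variable {S : SpectralSetup H} {s : ℝ≥0} {ν : Measure (S.Hneg s)} {h : S.Hneg s → ℝ}
  {g : S.Hneg s → S.Hneg s}

theorem gibbs_eq_tilted [NeZero ν] (hexp : Integrable (fun u => Real.exp (-h u)) ν) :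
    S.gibbs s ν h = ν.tilted (fun u => -h u) := by
  have hpos : 0 < ∫ u, Real.exp (-h u) ∂ν := integral_exp_pos hexp
  rw [gibbs, ← ofReal_integral_eq_lintegral_ofReal hexp (.of_forall fun _ => (Real.exp_pos _).le),
    ← withDensity_smul' _ _ (ENNReal.inv_ne_top.2 (ENNReal.ofReal_pos.2 hpos).ne'), Measure.tilted]
  congr with u
  rw [Pi.smul_apply, smul_eq_mul, ENNReal.ofReal_div_of_pos hpos, ENNReal.div_eq_inv_mul]

theorem isProbabilityMeasure_gibbs [NeZero ν] (hexp : Integrable (fun u => Real.exp (-h u)) ν) :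
    IsProbabilityMeasure (S.gibbs s ν h) :=
  gibbs_eq_tilted hexp ▸ isProbabilityMeasure_tilted hexp

theorem integrable_gibbs_of_memLp_two [IsProbabilityMeasure ν]
    (hexp : MemLp (fun u => Real.exp (-h u)) 2 ν) {E : Type*} [NormedAddCommGroup E]
    [NormedSpace ℝ E] {f : S.Hneg s → E} (hf : MemLp f 2 ν) : Integrable f (S.gibbs s ν h) := by
  rw [gibbs_eq_tilted (hexp.integrable one_le_two)]
  exact integrable_tilted_of_memLp_two hexp hf

theorem hasFominDivergence_gibbs (hν : S.IsGaussian s ν) (hh : S.IsMalliavinDeriv s ν h g)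
    (hexp : MemLp (fun u => Real.exp (-h u)) 2 ν) (k : ℕ) {c : ℂ} (hc : ‖c‖ = 1) :
    HasFominDivergence (S.gibbs s ν h) (S.dir s k c)
      (fun u => S.lam k * S.rcoord s k c u + S.rcoord s k c (g u)) := by
  have := hν.1
  have hβ2 : MemLp (fun u => S.lam k * S.rcoord s k c u) 2 ν :=
    (hν.memLp_rcoord k hc 2).const_mul _
  rw [gibbs_eq_tilted (hexp.integrable one_le_two)]
  exact ((hh.hasSobolevLineDeriv k c).exp_neg
    (hν.hasFominDivergence k hc) hβ2 hexp).hasFominDivergence_tilted hβ2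

theorem integrable_coordsL_gibbs (hν : S.IsGaussian s ν)
    (hexp : MemLp (fun u => Real.exp (-h u)) 2 ν) (n : ℕ) :
    Integrable (S.coordsL s n) (S.gibbs s ν h) := by
  have := hν.1
  refine integrable_gibbs_of_memLp_two hexp (memLp_pi_iff.2 fun k => memLp_re_im_iff.1 ⟨?_, ?_⟩)
  · exact (hν.memLp_rcoord k norm_one 2).ae_eq (.of_forall fun u => by
      simp [rcoord_apply, coordsL_apply])
  · exact (hν.memLp_rcoord k norm_I 2).ae_eq (.of_forall fun u => by
      simp [rcoord_apply, coordsL_apply])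

end Gibbs

/-! ### Stationarity -/

theorem pairing_hamiltonian_field (S : SpectralSetup H) (s : ℝ≥0) {n : ℕ} (φ : (Fin n → ℂ) → ℝ)
    (u v : S.Hneg s) :
    S.pairing (fun k => -I * S.applyA (S.coord s u) k - I * S.coord s v k) (S.cylGrad s φ u) =
      ∑ k : Fin n, (fderiv ℝ φ (S.coordsL s n u) (Pi.single k 1) *
          (S.lam k * S.rcoord s k I u + S.rcoord s k I v) -
        fderiv ℝ φ (S.coordsL s n u) (Pi.single k I) *
          (S.lam k * S.rcoord s k 1 u + S.rcoord s k 1 v)) := by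
  rw [pairing_cylGrad, apply_eq_sum_single_one_add_single_I]
  refine Finset.sum_congr rfl fun k _ => ?_
  simp [applyA, rcoord_apply]
  ring

theorem stationarity {S : SpectralSetup H} {s : ℝ≥0} {ν : Measure (S.Hneg s)}
    (hν : S.IsGaussian s ν) {h : S.Hneg s → ℝ} {g : S.Hneg s → S.Hneg s}
    (hh : S.IsMalliavinDeriv s ν h g) (hexp : MemLp (fun u => Real.exp (-h u)) 2 ν)
    {n : ℕ} {φ : (Fin n → ℂ) → ℝ} (hφ : IsCbInfty φ) :
    Integrable (fun u => S.pairing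
        (fun k => -I * S.applyA (S.coord s u) k - I * S.coord s (g u) k)
        (S.cylGrad s φ u)) (S.gibbs s ν h) ∧
      ∫ u, S.pairing (fun k => -I * S.applyA (S.coord s u) k - I * S.coord s (g u) k)
        (S.cylGrad s φ u) ∂(S.gibbs s ν h) = 0 := by
  have hdiv (k : Fin n) {c : ℂ} (hc : ‖c‖ = 1) := hasFominDivergence_gibbs hν hh hexp k hc
  have htest (k : Fin n) (a c : ℂ) :
      IsTestAlong (S.dir s k c) (fun u => fderiv ℝ φ (S.coordsL s n u) (Pi.single k a))
        (fun u => fderiv ℝ (fun w => fderiv ℝ φ w (Pi.single k a)) (S.coordsL s n u)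
          (Pi.single k c)) := by
    simpa only [ContinuousLinearMap.coe_restrictScalars', coordsL_dir] using
      (hφ.fderiv_apply (Pi.single k a)).isTestAlong
        ((S.coordsL s n).restrictScalars ℝ) (S.dir s k c)
  have hint (k : Fin n) := Integrable.sub'
    ((htest k 1 I).integrable_mul (hdiv k norm_I).integrable)
      ((htest k I 1).integrable_mul (hdiv k norm_one).integrable)
  simp only [pairing_hamiltonian_field]
  refine ⟨integrable_finsetSum _ fun k _ => hint k, ?_⟩
  rw [integral_finsetSum _ fun k _ => hint k]
  refine Finset.sum_eq_zero fun k _ => ?_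
  have hcomm := htest k I 1
  simp only [hφ.fderiv_fderiv_apply_comm (Pi.single k I)] at hcomm
  exact (hdiv k norm_one).integral_hamiltonian (hdiv k norm_I) (htest k 1 I) hcomm

end SpectralSetup

/-! ### The Liouville equation -/

section IntegralAlongCurves

variable {α V F : Type*} [MeasurableSpace α] {μ : Measure α} [NormedAddCommGroup V]
  [NormedSpace ℝ V] [NormedAddCommGroup F] [NormedSpace ℝ F]

theorem integrable_clm_apply {L : α → V →L[ℝ] F} {a : α → V} (hL : AEStronglyMeasurable L μ)
    {M : ℝ} (hM : ∀ x, ‖L x‖ ≤ M) (ha : Integrable a μ) : Integrable (fun x => L x (a x)) μ :=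
  (ContinuousLinearMap.id ℝ (V →L[ℝ] F)).integrable_of_bilin_of_bdd_left M hL (.of_forall hM) ha

theorem hasDerivAt_integral_comp_curve [IsFiniteMeasure μ] {φ : V → F} (hφ : Differentiable ℝ φ)
    (hφ' : Continuous (fderiv ℝ φ)) {C M : ℝ} (hC : ∀ z, ‖φ z‖ ≤ C) (hM : ∀ z, ‖fderiv ℝ φ z‖ ≤ M)
    {c c' : ℝ → α → V} (hc : ∀ τ x, HasDerivAt (fun σ => c σ x) (c' τ x) τ)
    (hc_meas : ∀ τ, AEStronglyMeasurable (c τ) μ) {t : ℝ} (hc'_int : Integrable (c' t) μ)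
    {b : α → ℝ} (hb : Integrable b μ) (hc'_le : ∀ τ x, ‖c' τ x‖ ≤ b x) :
    HasDerivAt (fun τ => ∫ x, φ (c τ x) ∂μ) (∫ x, fderiv ℝ φ (c t x) (c' t x) ∂μ) t := by
  have hmeas (τ : ℝ) : AEStronglyMeasurable (fun x => φ (c τ x)) μ :=
    hφ.continuous.comp_aestronglyMeasurable (hc_meas τ)
  have hderiv : Integrable (fun x => fderiv ℝ φ (c t x) (c' t x)) μ :=
    integrable_clm_apply (hφ'.comp_aestronglyMeasurable (hc_meas t)) (fun _ => hM _) hc'_int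
  refine (hasDerivAt_integral_of_dominated_loc_of_deriv_le (bound := fun x => M * b x) univ_mem
    (.of_forall hmeas) (.of_bound (hmeas t) C (.of_forall fun _ => hC _))
    (F' := fun τ x => fderiv ℝ φ (c τ x) (c' τ x)) hderiv.1
    (.of_forall fun x τ _ => ?_) (hb.const_mul M) (.of_forall fun x τ _ => ?_)).2
  · exact (fderiv ℝ φ (c τ x)).le_of_opNorm_le_of_le (hM _) (hc'_le τ x)
  · exact (hφ _).hasFDerivAt.comp_hasDerivAt τ (hc τ x)

end IntegralAlongCurves

namespace SpectralSetup

variable {H : Type*} [NormedAddCommGroup H] [InnerProductSpace ℂ H] [CompleteSpace H]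

section FiniteFlow

variable (S : SpectralSetup H) (n : ℕ)

/-- The flow `e^{itA}` in the first `n` coordinates. -/
def finFlow (t : ℝ) : (Fin n → ℂ) →L[ℝ] (Fin n → ℂ) :=
  .pi fun k => S.expMul t k • .proj (R := ℝ) k

/-- The generator `iA` of the flow in the first `n` coordinates. -/
def finGen : (Fin n → ℂ) →L[ℝ] (Fin n → ℂ) :=
  .pi fun k => (I * S.lam k) • .proj (R := ℝ) k

theorem finFlow_apply (t : ℝ) (z : Fin n → ℂ) (k : Fin n) :
    S.finFlow n t z k = S.expMul t k * z k := rfl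

theorem finGen_apply (z : Fin n → ℂ) (k : Fin n) : S.finGen n z k = I * S.lam k * z k := rfl

theorem norm_finFlow (t : ℝ) (z : Fin n → ℂ) : ‖S.finFlow n t z‖ = ‖z‖ := by
  have hexpMul (k : ℕ) : ‖S.expMul t k‖₊ = 1 := NNReal.eq (S.norm_expMul t k)
  simp only [Pi.norm_def, finFlow_apply, nnnorm_mul, hexpMul, one_mul]

theorem hasDerivAt_finFlow (t : ℝ) (z : Fin n → ℂ) :
    HasDerivAt (fun τ => S.finFlow n τ z) (S.finFlow n t (S.finGen n z)) t := by
  refine hasDerivAt_pi.2 fun k => ((S.hasDerivAt_expMul t k).mul_const (z k)).congr_deriv ?_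
  rw [finFlow_apply, finGen_apply]
  ring

theorem coordsL_flow (s : ℝ≥0) (t : ℝ) (u : S.Hneg s) :
    S.coordsL s n (S.flow s t u) = S.finFlow n t (S.coordsL s n u) :=
  funext fun k => S.coord_flow s t u k

end FiniteFlow

section Transport

variable (S : SpectralSetup H) (s : ℝ≥0) (ν : Measure (S.Hneg s)) (h : S.Hneg s → ℝ)
  (g : S.Hneg s → S.Hneg s)

theorem vectorField_flow (t : ℝ) (u : S.Hneg s) :
    S.vectorField s g t (S.flow s t u) = S.flow s t (-I • g u) := by
  rw [vectorField, flow_neg_flow, neg_smul, map_neg, map_smul]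

theorem norm_vectorField_flow (t : ℝ) (u : S.Hneg s) :
    ‖S.vectorField s g t (S.flow s t u)‖ = ‖g u‖ := by
  rw [vectorField_flow, norm_flow, norm_smul, norm_neg, norm_I, one_mul]

theorem integral_gibbsAt (t : ℝ) (f : S.Hneg s → ℝ) :
    ∫ u, f u ∂(S.gibbsAt s ν h t) = ∫ u, f (S.flow s t u) ∂(S.gibbs s ν h) :=
  (S.measurableEmbedding_flow s t).integral_map f

theorem integrable_gibbsAt_iff (t : ℝ) {E : Type*} [NormedAddCommGroup E] (f : S.Hneg s → E) :
    Integrable f (S.gibbsAt s ν h t) ↔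
      Integrable (fun u => f (S.flow s t u)) (S.gibbs s ν h) :=
  (S.measurableEmbedding_flow s t).integrable_map_iff

theorem continuous_integral_gibbsAt [IsFiniteMeasure (S.gibbs s ν h)]
    (F : BoundedContinuousFunction (S.Hneg s) ℝ) :
    Continuous fun t : ℝ => ∫ u, F u ∂(S.gibbsAt s ν h t) := by
  simp only [integral_gibbsAt]
  exact continuous_of_dominated (bound := fun _ => ‖F‖)
    (fun t => (F.continuous.comp (S.flow s t).continuous).aestronglyMeasurable)
    (fun t => .of_forall fun u => F.norm_coe_le_norm _) (integrable_const _)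
    (.of_forall fun u => F.continuous.comp (S.continuous_flow s u))

variable {ν h g} in
theorem integrable_vectorField (hg : Integrable g (S.gibbs s ν h)) (t : ℝ) :
    Integrable (S.vectorField s g t) (S.gibbsAt s ν h t) := by
  rw [integrable_gibbsAt_iff]
  simp only [vectorField_flow]
  exact (S.flow s t).integrable_comp (hg.smul (-I))

variable {n : ℕ} {φ : (Fin n → ℂ) → ℝ}

theorem pairing_vectorField_flow (φ : (Fin n → ℂ) → ℝ) (t : ℝ) (u : S.Hneg s) :
    S.pairing (S.coord s (S.vectorField s g t (S.flow s t u))) (S.cylGrad s φ (S.flow s t u)) =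
      fderiv ℝ φ (S.finFlow n t (S.coordsL s n u))
        (S.finFlow n t (-I • S.coordsL s n (g u))) := by
  rw [pairing_cylGrad, vectorField_flow, ← coordsL_apply, coordsL_flow, coordsL_flow, map_smul]

/-- With `φ ∘ finFlow n t` in place of `φ`, stationarity compares the transport along `e^{itA}` with
the pairing against the vector field. -/
theorem pairing_hamiltonian_field_comp_finFlow (hφ : Differentiable ℝ φ) (t : ℝ) (u v : S.Hneg s) :
    S.pairing (fun k => -I * S.applyA (S.coord s u) k - I * S.coord s v k)
        (S.cylGrad s (φ ∘ S.finFlow n t) u) =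
      fderiv ℝ φ (S.finFlow n t (S.coordsL s n u)) (S.finFlow n t (-I • S.coordsL s n v)) -
        fderiv ℝ φ (S.finFlow n t (S.coordsL s n u))
          (S.finFlow n t (S.finGen n (S.coordsL s n u))) := by
  rw [pairing_cylGrad, fderiv_comp _ (hφ _) (S.finFlow n t).differentiableAt,
    ContinuousLinearMap.fderiv, ContinuousLinearMap.comp_apply, ← map_sub, ← map_sub]
  congr 2
  funext k
  simp only [Pi.sub_apply, Pi.smul_apply, finGen_apply, coordsL_apply, applyA, smul_eq_mul]
  ring

variable {ν h} in
theorem hasDerivAt_integral_cyl_gibbsAt [IsFiniteMeasure (S.gibbs s ν h)]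
    (hcoords : Integrable (S.coordsL s n) (S.gibbs s ν h)) (hφ : IsCbInfty φ) (t : ℝ) :
    HasDerivAt (fun τ => ∫ u, S.cyl s φ u ∂(S.gibbsAt s ν h τ))
      (∫ u, fderiv ℝ φ (S.finFlow n t (S.coordsL s n u))
        (S.finFlow n t (S.finGen n (S.coordsL s n u))) ∂(S.gibbs s ν h)) t := by
  obtain ⟨C, hC⟩ := hφ.bounded
  obtain ⟨M, hM⟩ := hφ.fderiv_bounded
  have hgen : Integrable (fun u => S.finGen n (S.coordsL s n u)) (S.gibbs s ν h) :=
    (S.finGen n).integrable_comp hcoords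
  simp only [integral_gibbsAt, cyl, ← coordsL_apply, coordsL_flow]
  exact hasDerivAt_integral_comp_curve hφ.differentiable hφ.continuous_fderiv hC hM
    (fun τ u => S.hasDerivAt_finFlow n τ (S.coordsL s n u))
    (fun τ => ((S.finFlow n τ).integrable_comp hcoords).1) ((S.finFlow n t).integrable_comp hgen)
    hgen.norm (fun τ u => (S.norm_finFlow n τ _).le)

end Transport

theorem liouville {S : SpectralSetup H} {s : ℝ≥0} {ν : Measure (S.Hneg s)}
    (hν : S.IsGaussian s ν) {h : S.Hneg s → ℝ} {g : S.Hneg s → S.Hneg s}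
    (hh : S.IsMalliavinDeriv s ν h g) (hexp : MemLp (fun u => Real.exp (-h u)) 2 ν)
    {n : ℕ} {φ : (Fin n → ℂ) → ℝ} (hφ : IsCbInfty φ) (t : ℝ) :
    Integrable (fun u => S.pairing (S.coord s (S.vectorField s g t u)) (S.cylGrad s φ u))
        (S.gibbsAt s ν h t) ∧
      HasDerivAt (fun τ : ℝ => ∫ u, S.cyl s φ u ∂(S.gibbsAt s ν h τ))
        (∫ u, S.pairing (S.coord s (S.vectorField s g t u)) (S.cylGrad s φ u)
          ∂(S.gibbsAt s ν h t)) t := by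
  have := hν.1
  have := isProbabilityMeasure_gibbs (S := S) (s := s) (hexp.integrable one_le_two)
  obtain ⟨M, hM⟩ := hφ.fderiv_bounded
  have hcoords := integrable_coordsL_gibbs hν hexp n
  have hg : Integrable g (S.gibbs s ν h) := integrable_gibbs_of_memLp_two hexp hh.2.1
  have hint {a : S.Hneg s → Fin n → ℂ} (ha : Integrable a (S.gibbs s ν h)) :
      Integrable (fun u => fderiv ℝ φ (S.finFlow n t (S.coordsL s n u)) (S.finFlow n t (a u)))
        (S.gibbs s ν h) :=
    integrable_clm_apply (hφ.continuous_fderiv.comp_aestronglyMeasurable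
      ((S.finFlow n t).integrable_comp hcoords).1) (fun _ => hM _)
      ((S.finFlow n t).integrable_comp ha)
  have hfield := hint (((S.coordsL s n).integrable_comp hg).fun_smul (-I))
  have hgen := hint ((S.finGen n).integrable_comp hcoords)
  have hstat := (stationarity hν hh hexp (hφ.comp_clm (S.finFlow n t))).2
  simp only [S.pairing_hamiltonian_field_comp_finFlow s hφ.differentiable] at hstat
  rw [integral_sub hfield hgen, sub_eq_zero] at hstat
  rw [integrable_gibbsAt_iff, integral_gibbsAt]
  simp only [pairing_vectorField_flow]
  exact ⟨hfield, hstat ▸ S.hasDerivAt_integral_cyl_gibbsAt s hcoords hφ t⟩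

end SpectralSetup

end

theorem mainTheorem6 {H : Type*} [NormedAddCommGroup H] [InnerProductSpace ℂ H] [CompleteSpace H]
    (S : SpectralSetup H) (s : ℝ≥0)
    (hs : Summable fun k => S.lam k ^ (-((s : ℝ) + 1)))
    (ν₀ : Measure (S.Hneg s)) (hν₀ : S.IsGaussian s ν₀)
    (h : S.Hneg s → ℝ) (gradh : S.Hneg s → S.Hneg s)
    (hh : S.IsMalliavinDeriv s ν₀ h gradh)
    (hexp : MemLp (fun u => Real.exp (-h u)) 2 ν₀) :
    -- the Gibbs measure is a probability measure
    IsProbabilityMeasure (S.gibbs s ν₀ h) ∧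
    -- stationarity of the Gibbs measure
    (∀ (n : ℕ) (φ : (Fin n → ℂ) → ℝ), SpectralSetup.IsCbInfty φ →
      Integrable (fun u => S.pairing
        (fun k => -I * S.applyA (S.coord s u) k - I * S.coord s (gradh u) k)
        (S.cylGrad s φ u)) (S.gibbs s ν₀ h) ∧
      ∫ u, S.pairing
        (fun k => -I * S.applyA (S.coord s u) k - I * S.coord s (gradh u) k)
        (S.cylGrad s φ u) ∂(S.gibbs s ν₀ h) = 0) ∧
    -- narrow continuity of the curve of transported Gibbs measures
    (∀ F : BoundedContinuousFunction (S.Hneg s) ℝ,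
      Continuous fun t : ℝ => ∫ u, F u ∂(S.gibbsAt s ν₀ h t)) ∧
    -- integrability of the vector field along the curve
    (∀ t : ℝ, Integrable (S.vectorField s gradh t) (S.gibbsAt s ν₀ h t)) ∧
    Integrable (fun t : ℝ =>
      (∫ u, ‖S.vectorField s gradh t u‖ ∂(S.gibbsAt s ν₀ h t)) / (1 + t ^ 2)) ∧
    -- the statistical Liouville equation
    (∀ (n : ℕ) (φ : (Fin n → ℂ) → ℝ), SpectralSetup.IsCbInfty φ → ∀ t : ℝ,
      Integrable (fun u => S.pairing (S.coord s (S.vectorField s gradh t u)) (S.cylGrad s φ u))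
        (S.gibbsAt s ν₀ h t) ∧
      HasDerivAt (fun τ : ℝ => ∫ u, S.cyl s φ u ∂(S.gibbsAt s ν₀ h τ))
        (∫ u, S.pairing (S.coord s (S.vectorField s gradh t u)) (S.cylGrad s φ u)
          ∂(S.gibbsAt s ν₀ h t)) t) := by
  have := hν₀.1
  have hprob : IsProbabilityMeasure (S.gibbs s ν₀ h) :=
    SpectralSetup.isProbabilityMeasure_gibbs (hexp.integrable one_le_two)
  have hg : Integrable gradh (S.gibbs s ν₀ h) :=
    SpectralSetup.integrable_gibbs_of_memLp_two hexp hh.2.1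
  refine ⟨hprob, fun n φ hφ => SpectralSetup.stationarity hν₀ hh hexp hφ,
    S.continuous_integral_gibbsAt s ν₀ h, S.integrable_vectorField s hg, ?_,
    fun n φ hφ t => SpectralSetup.liouville hν₀ hh hexp hφ t⟩
  simp only [SpectralSetup.integral_gibbsAt, SpectralSetup.norm_vectorField_flow, div_eq_mul_inv]
  exact integrable_inv_one_add_sq.const_mul _
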